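/- Let $k$ be an algebraically closed field and let $\Lambda = kQ/I$ be a gentle algebra: $Q$ is a finite quiver, $I$ is an admissible ideal of $kQ$ generated by paths of length two, at most two arrows start and at most two arrows end at each vertex, and for each arrow $a$ there is at most one arrow $b$ with $ba \notin I$, at most one arrow $c$ with $ac \notin I$, at most one arrow $b$ with $s(b)=e(a)$ and $ba \in I$, and at most one arrow $c$ with $e(c)=s(a)$ and $ac \in I$. Paths are read from right to left, modules are left modules, and maps are composed from left to right. A homotopy letter is a nontrivial path $p$ in $Q$ with $p \notin I$ (a direct letter) or the formal inverse $\overline{p}$ of such a path (an inverse letter). A homotopy string is a (finite or infinite, possibly trivial) sequence of letters $\sigma = \cdots \sigma_{i+1}\sigma_i \cdots$ in which consecutive letters have matching endpoints; if two consecutive letters point in the same direction, the two arrows that meet compose to an element of $I$, and if they point in opposite directions, the two arrows that meet are different; a string that is infinite on the left (on the right) is there eventually a sequence of direct letters (inverse letters) of length one. Its string complex $P^\bullet_\sigma$ is the direct sum of the projectives $P(x) = \Lambda e_x$ over the vertices $x$ between the letters (and at the ends), placed in degrees such that each direct letter $p$ goes one degree up from left to right and each inverse letter $\overline{p}$ goes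 one degree up from right to left; the differential is given by right multiplication by the paths $p$. For the empty string, $P^\bullet_\emptyset = 0$. Let $\sigma = \beta\sigma_L\sigma_R\alpha$ and $\tau = \delta\tau_L\tau_R\gamma$ be homotopy strings, where each of the letters $\sigma_L,\sigma_R,\tau_L,\tau_R$ may be empty, in which case the adjacent substring $\beta,\alpha,\delta,\gamma$ is empty too. Let $f$ be a nontrivial path not in $I$ which gives a map $P(x) \to P(y)$ by right multiplication, where $x$ is the vertex between $\sigma_L$ and $\sigma_R$ and $y$ is the vertex between $\tau_L$ and $\tau_R$, both in the same degree. Suppose that $f$ is the single component of a singleton single map $f^\bullet \colon P^\bullet_\sigma \to P^\bullet_\tau$ and that $\sigma$ and $\tau$ are compatibly oriented for it, that is: 1. if $\sigma_R \neq \emptyset$ then $\sigma_R = f f_R$, and if $\tau_R \neq \emptyset$ then $\tau_R = \overline{f}\,\overline{f_L}$, for nontrivial paths $f_R$, $f_L$; 2. if $\sigma_L$ is direct then $\sigma_L f \in I$, and if $\tau_L$ is inverse then $f\,\overline{\tau_L} \in I$; 3. if $\sigma_L = \overline{p}$ is inverse then neither of $f$ and $p$ is an initial (left) segment of the other, and if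 $\tau_L = q$ is direct then neither of $f$ and $q$ is a final (right) segment of the other. Then the mapping cone $M^\bullet_{f^\bullet}$ is isomorphic, as a complex of $\Lambda$-modules, to $P^\bullet_{c_1} \oplus P^\bullet_{c_2}$, where $c_1$ and $c_2$ are homotopy strings (or $c_2=\emptyset$) given by $$c_1 = \begin{cases} \beta\sigma_L f\,\overline{\tau_L}\,\overline{\delta} & \text{if } \sigma_L \neq \emptyset,\ \tau_L \neq \emptyset,\\ \beta\sigma_L f & \text{if } \sigma_L \neq \emptyset,\ \tau_L = \emptyset,\\ f\,\overline{\tau_L}\,\overline{\delta} & \text{if } \sigma_L = \emptyset,\ \tau_L \neq \emptyset,\\ f & \text{if } \sigma_L = \tau_L = \emptyset,\end{cases} \qquad c_2 = \begin{cases} \overline{\gamma} f_L f f_R \alpha & \text{if } \sigma_R \neq \emptyset,\ \tau_R \neq \emptyset,\\ \alpha & \text{if } \sigma_R \neq \emptyset,\ \tau_R = \emptyset,\\ \overline{\gamma} & \text{if } \sigma_R = \emptyset,\ \tau_R \neq \emptyset,\\ \emptyset & \text{if } \sigma_R = \tau_R = \emptyset.\end{cases}$$ In $c_1$ the letter $f$,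 and in the first case of $c_2$ the letter $f_L f f_R$, is a single direct homotopy letter; if $\sigma_R \neq \emptyset$ has no letter to its right then $\alpha$ is the trivial string at the right end of $\sigma_R$, and similarly for $\gamma$. The vertices of $c_1$ and $c_2$ that come from $\sigma$ sit one degree lower than in $P^\bullet_\sigma$, and those that come from $\tau$ sit in the same degree as in $P^\bullet_\tau$. -/

import Mathlib

open CategoryTheory CategoryTheory.Limits

noncomputable section

namespace GentleCone

/-! ### Quivers and path algebras

Modules are left modules and paths are read from right to left: the path `a_n ⋯ a_1`
is stored as the list `[a_n, …, a_1]`, with `s (a_{i+1}) = e (a_i)`. -/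

/-- A quiver with set of vertices `V` and set of arrows `E`; `s a` and `e a` are the start and the
end of the arrow `a`. -/
structure Quiv (V E : Type*) where
  s : E → V
  e : E → V

variable {k V E : Type*}

/-- `Q.IsPath y p x`: the list of arrows `p` (read from right to left) is a path in `Q` which
starts at `x` and ends at `y`; the empty list is the trivial path, with `y = x`. -/
def Quiv.IsPath (Q : Quiv V E) : V → List E → V → Prop
  | y, [], x => y = x
  | y, a :: l, x => Q.e a = y ∧ Q.IsPath (Q.s a) l x

theorem Quiv.IsPath.append {Q : Quiv V E} {p q : List E} :
    ∀ {z y x : V}, Q.IsPath z p y → Q.IsPath y q x → Q.IsPath z (p ++ q) x := by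
  induction p with
  | nil => intro z y x h h'; cases h; exact h'
  | cons a l ih => intro z y x h h'; exact ⟨h.1, ih h.2 h'⟩

/-- Paths in `Q`, trivial paths included. -/
@[ext]
structure QPath (Q : Quiv V E) where
  tgt : V
  arrows : List E
  src : V
  isPath : Q.IsPath tgt arrows src

namespace QPath

variable {Q : Quiv V E}

/-- The trivial path at `x`. -/
def triv (Q : Quiv V E) (x : V) : QPath Q := ⟨x, [], x, rfl⟩

/-- The path consisting of one arrow. -/
def arrow (Q : Quiv V E) (a : E) : QPath Q := ⟨Q.e a, [a], Q.s a, rfl, rfl⟩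

/-- The concatenation `p q` (first `q`, then `p`). -/
def comp (p q : QPath Q) (h : p.src = q.tgt) : QPath Q :=
  ⟨p.tgt, p.arrows ++ q.arrows, q.src, p.isPath.append (h ▸ q.isPath)⟩

end QPath

/-- The path algebra `kQ`: the vector space with basis the paths of `Q`. -/
def PathAlgebra (k : Type*) [Field k] (Q : Quiv V E) := QPath Q →₀ k

namespace PathAlgebra

variable [Field k] (Q : Quiv V E)

instance : AddCommGroup (PathAlgebra k Q) := inferInstanceAs (AddCommGroup (QPath Q →₀ k))
instance : Module k (PathAlgebra k Q) := inferInstanceAs (Module k (QPath Q →₀ k))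

variable {Q}

/-- The basis element given by a path. -/
def basis (p : QPath Q) : PathAlgebra k Q := Finsupp.single p 1

/-- The coefficient of an element of `kQ` at a path. -/
def coeff (u : PathAlgebra k Q) (p : QPath Q) : k := (show QPath Q →₀ k from u) p

open Classical in
/-- The product of two basis elements: the concatenation if defined, and zero otherwise. -/
def mulBasis (p q : QPath Q) : PathAlgebra k Q :=
  if h : p.src = q.tgt then basis (p.comp q h) else 0

/-- The linear extension of a function on paths. -/
def lift {M : Type*} [AddCommGroup M] [Module k M] (φ : QPath Q → M) : PathAlgebra k Q →ₗ[k] M :=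
  (Finsupp.linearCombination k φ : (QPath Q →₀ k) →ₗ[k] M)

theorem lift_basis {M : Type*} [AddCommGroup M] [Module k M] (φ : QPath Q → M) (p : QPath Q) :
    lift (k := k) φ (basis p) = φ p :=
  (Finsupp.linearCombination_single k (1 : k) p).trans (one_smul k _)

/-- The bilinear extension of the product of basis elements. -/
def mulHom : PathAlgebra k Q →ₗ[k] PathAlgebra k Q →ₗ[k] PathAlgebra k Q :=
  lift fun p => lift fun q => mulBasis p q

instance : Mul (PathAlgebra k Q) := ⟨fun u v => mulHom u v⟩

instance [Fintype V] : One (PathAlgebra k Q) := ⟨∑ x, basis (QPath.triv Q x)⟩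

theorem mul_def (u v : PathAlgebra k Q) : u * v = mulHom u v := rfl

theorem one_def [Fintype V] : (1 : PathAlgebra k Q) = ∑ x, basis (QPath.triv Q x) := rfl

theorem basis_mul_basis (p q : QPath Q) :
    (basis p * basis q : PathAlgebra k Q) = mulBasis p q := by
  rw [mul_def, mulHom, lift_basis, lift_basis]

theorem hom_ext {M : Type*} [AddCommGroup M] [Module k M] {φ ψ : PathAlgebra k Q →ₗ[k] M}
    (h : ∀ p, φ (basis p) = ψ (basis p)) : φ = ψ :=
  Finsupp.lhom_ext' fun p => LinearMap.ext_ring (h p)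

theorem mul_assoc_basis (p q r : QPath Q) :
    (basis p * basis q * basis r : PathAlgebra k Q) = basis p * (basis q * basis r) := by
  simp only [basis_mul_basis, mulBasis]
  split_ifs with h h' h'
  · rw [basis_mul_basis, basis_mul_basis]
    unfold mulBasis
    rw [dif_pos (show (p.comp q h).src = r.tgt from h'),
      dif_pos (show p.src = (q.comp r h').tgt from h)]
    congr 1
    exact QPath.ext rfl (List.append_assoc _ _ _) rfl
  · rw [basis_mul_basis, mulBasis, dif_neg (show ¬ (p.comp q h).src = r.tgt from h')]
    simp [mul_def]
  · rw [basis_mul_basis, mulBasis, dif_neg (show ¬ p.src = (q.comp r h').tgt from h)]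
    simp [mul_def]
  · simp [mul_def]

theorem mul_assoc' (u v w : PathAlgebra k Q) : u * v * w = u * (v * w) := by
  have key : (mulHom (k := k) (Q := Q)).compr₂ mulHom =
      (LinearMap.llcomp k _ _ _).flip mulHom ∘ₗ (LinearMap.llcomp k _ _ _) ∘ₗ
        (mulHom (k := k) (Q := Q)) := by
    refine hom_ext fun p => hom_ext fun q => hom_ext fun r => ?_
    exact mul_assoc_basis p q r
  exact LinearMap.congr_fun (LinearMap.congr_fun (LinearMap.congr_fun key u) v) w

theorem one_mul' [Fintype V] (u : PathAlgebra k Q) : 1 * u = u := by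
  have key : mulHom (1 : PathAlgebra k Q) = LinearMap.id := by
    refine hom_ext fun p => ?_
    rw [one_def, map_sum, LinearMap.sum_apply, Finset.sum_eq_single p.tgt]
    · rw [← mul_def, basis_mul_basis, mulBasis, dif_pos (show (QPath.triv Q p.tgt).src = p.tgt from rfl)]
      rfl
    · intro x _ hx
      rw [← mul_def, basis_mul_basis, mulBasis,
        dif_neg (show ¬ (QPath.triv Q x).src = p.tgt from hx)]
    · intro h; exact absurd (Finset.mem_univ _) h
  exact LinearMap.congr_fun key u

theorem mul_one' [Fintype V] (u : PathAlgebra k Q) : u * 1 = u := by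
  have key : (mulHom (k := k) (Q := Q)).flip 1 = LinearMap.id := by
    refine hom_ext fun p => ?_
    rw [one_def, LinearMap.flip_apply, map_sum, Finset.sum_eq_single p.src]
    · rw [← mul_def, basis_mul_basis, mulBasis, dif_pos (show p.src = (QPath.triv Q p.src).tgt from rfl)]
      change basis _ = basis _
      congr 1
      exact QPath.ext rfl (List.append_nil _) rfl
    · intro x _ hx
      rw [← mul_def, basis_mul_basis, mulBasis,
        dif_neg (show ¬ p.src = (QPath.triv Q x).tgt from fun h => hx h.symm)]
    · intro h; exact absurd (Finset.mem_univ _) h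
  exact LinearMap.congr_fun key u

instance [Fintype V] : Ring (PathAlgebra k Q) where
  __ := (inferInstance : AddCommGroup (PathAlgebra k Q))
  mul := (· * ·)
  one := 1
  left_distrib u v w := by simp [mul_def]
  right_distrib u v w := by simp [mul_def]
  zero_mul u := by simp [mul_def]
  mul_zero u := by simp [mul_def]
  mul_assoc := mul_assoc'
  one_mul := one_mul'
  mul_one := mul_one'

variable (k Q)

/-- The element of `kQ` given by a list of arrows, namely the product of its arrows. This is the
basis element of the path if consecutive arrows are composable, and zero otherwise. -/
def ofArrows [Fintype V] (p : List E) : PathAlgebra k Q :=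
  (p.map fun a => basis (QPath.arrow Q a)).prod

end PathAlgebra

open PathAlgebra (basis ofArrows)

variable [Field k] [Fintype V]

/-! ### Gentle algebras -/

/-- The ideal `I` of `kQ` is admissible, `J ^ m ⊆ I ⊆ J ^ 2` for some `m`, where `J` is the ideal
generated by the arrows (so that `J ^ m` is spanned by the paths of length at least `m`), and it
satisfies the conditions (1)-(4) making `kQ / I` a gentle algebra. -/
structure IsGentle (Q : Quiv V E) (I : Ideal (PathAlgebra k Q)) : Prop where
  nilpotent : ∃ m : ℕ, ∀ p : QPath Q, m ≤ p.arrows.length → basis p ∈ I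
  le_sq : ∀ u ∈ I, ∀ p : QPath Q, p.arrows.length < 2 → u.coeff p = 0
  card_start : ∀ x : V, {a : E | Q.s a = x}.encard ≤ 2
  card_end : ∀ x : V, {a : E | Q.e a = x}.encard ≤ 2
  left_unique : ∀ a b b' : E, ofArrows k Q [b, a] ∉ I → ofArrows k Q [b', a] ∉ I → b = b'
  right_unique : ∀ a c c' : E, ofArrows k Q [a, c] ∉ I → ofArrows k Q [a, c'] ∉ I → c = c'
  left_unique_rel : ∀ a b b' : E, Q.s b = Q.e a → Q.s b' = Q.e a →
    ofArrows k Q [b, a] ∈ I → ofArrows k Q [b', a] ∈ I → b = b'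
  right_unique_rel : ∀ a c c' : E, Q.e c = Q.s a → Q.e c' = Q.s a →
    ofArrows k Q [a, c] ∈ I → ofArrows k Q [a, c'] ∈ I → c = c'
  quadratic_monomial : ∃ R : Set (E × E), (∀ r ∈ R, Q.s r.1 = Q.e r.2) ∧
    I = Ideal.span {u | ∃ v w : PathAlgebra k Q, ∃ r ∈ R, u = v * ofArrows k Q [r.1, r.2] * w}

/-! ### Homotopy strings -/

/-- A homotopy letter: `dir p` is the direct letter `p`, and `inv p` is the inverse letter `p⁻¹`,
for a list of arrows `p`. -/
inductive Letter (E : Type*) where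
  | dir (p : List E) : Letter E
  | inv (p : List E) : Letter E

/-- The inverse of a letter. -/
def Letter.bar : Letter E → Letter E
  | .dir p => .inv p
  | .inv p => .dir p

/-- The data of a (finite or infinite) graded sequence of letters, drawn as an unfolded diagram with
vertices indexed by integers that decrease from left to right:
`⋯ — vtx 2 — vtx 1 — vtx 0 — vtx (-1) — ⋯`.
Only the vertices with index in `dom` are present. The letter between `vtx (i + 1)` and `vtx i` is
`letter i` (meaningful only if both `i` and `i + 1` are in `dom`), and `vtx i` sits in cohomological
degree `deg i`. -/
structure GWord (V E : Type*) where
  dom : Set ℤ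
  vtx : ℤ → V
  letter : ℤ → Letter E
  deg : ℤ → ℤ

section

variable (Q : Quiv V E) (I : Ideal (PathAlgebra k Q))

/-- `p` is a nontrivial path in `(Q, I)` which starts at `x` and ends at `y`. -/
def IsNontrivialPath (y : V) (p : List E) (x : V) : Prop :=
  p ≠ [] ∧ Q.IsPath y p x ∧ ofArrows k Q p ∉ I

/-- `l` is a letter of a graded sequence between the left vertex `y` in degree `m` and the right
vertex `x` in degree `n`: either `l` is direct (an arrow `y → x` of the unfolded diagram) and
`n = m + 1`, or it is inverse (an arrow `y ← x`) and `m = n + 1`. -/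
def IsLetter : Letter E → V → ℤ → V → ℤ → Prop
  | .dir p, y, m, x, n => IsNontrivialPath Q I y p x ∧ n = m + 1
  | .inv p, y, m, x, n => IsNontrivialPath Q I x p y ∧ m = n + 1

/-- The condition on two consecutive letters `l l'` (with `l` on the left) of a homotopy string: if
they point in the same direction then the two arrows that meet compose to an element of `I`, and if
they point in opposite directions then the two arrows that meet are different. -/
def Junction : Letter E → Letter E → Prop
  | .dir p, .dir q => ∀ a ∈ p.getLast?, ∀ b ∈ q.head?, ofArrows k Q [a, b] ∈ I
  | .inv p, .inv q => ∀ a ∈ q.getLast?, ∀ b ∈ p.head?, ofArrows k Q [a, b] ∈ I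
  | .dir p, .inv q => ∀ a ∈ p.getLast?, ∀ b ∈ q.getLast?, a ≠ b
  | .inv p, .dir q => ∀ a ∈ p.head?, ∀ b ∈ q.head?, a ≠ b

/-- `w` is a (finite or infinite, possibly trivial) graded homotopy string, decomposed into its
homotopy letters, or it is the empty string `∅` (if `w.dom` is empty). A string that is infinite on
the left is eventually a direct antipath there, and a string that is infinite on the right is
eventually an inverse antipath there. -/
structure IsHomotopyString (w : GWord V E) : Prop where
  interval : w.dom.OrdConnected
  letters : ∀ i, i + 1 ∈ w.dom → i ∈ w.dom →
    IsLetter Q I (w.letter i) (w.vtx (i + 1)) (w.deg (i + 1)) (w.vtx i) (w.deg i)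
  junctions : ∀ i, i + 1 + 1 ∈ w.dom → i + 1 ∈ w.dom → i ∈ w.dom →
    Junction Q I (w.letter (i + 1)) (w.letter i)
  left_infinite : ¬ BddAbove w.dom →
    ∃ m, ∀ i, m ≤ i → i + 1 ∈ w.dom → i ∈ w.dom → ∃ a, w.letter i = .dir [a]
  right_infinite : ¬ BddBelow w.dom →
    ∃ m, ∀ i, i ≤ m → i + 1 ∈ w.dom → i ∈ w.dom → ∃ a, w.letter i = .inv [a]

end

/-! ### String complexes -/

section

variable {Q : Quiv V E} (I : Ideal (PathAlgebra k Q)) [I.IsTwoSided]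

/-- The element of `Λ = kQ / I` given by a list of arrows. -/
def pathElt (p : List E) : PathAlgebra k Q ⧸ I := Ideal.Quotient.mk I (ofArrows k Q p)

/-- The indecomposable projective left module `P(x) = Λ e_x`, where `Λ = kQ / I`. -/
def proj (x : V) : Submodule (PathAlgebra k Q ⧸ I) (PathAlgebra k Q ⧸ I) :=
  Submodule.span _ {Ideal.Quotient.mk I (basis (QPath.triv Q x))}

/-- The degree `n` term `⨁ P(vtx i)` of the string complex, the sum over all `i ∈ dom` with
`deg i = n`, realized as the module of finitely supported families `(v i)` in `Λ` with `v i ∈ P(vtx i)`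
if `i ∈ dom` and `deg i = n`, and `v i = 0` otherwise. -/
def term (w : GWord V E) (n : ℤ) :
    Submodule (PathAlgebra k Q ⧸ I) (ℤ →₀ PathAlgebra k Q ⧸ I) where
  carrier := {v | ∀ i, v i ∈ proj I (w.vtx i) ∧ (v i ≠ 0 → i ∈ w.dom ∧ w.deg i = n)}
  add_mem' := by
    intro u v hu hv i
    refine ⟨add_mem (hu i).1 (hv i).1, fun h => ?_⟩
    by_cases h0 : u i = 0
    · refine (hv i).2 fun h1 => h ?_
      rw [Finsupp.add_apply, h0, h1, add_zero]
    · exact (hu i).2 h0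
  zero_mem' := fun i => ⟨zero_mem _, fun h => absurd rfl h⟩
  smul_mem' := by
    intro c v hv i
    refine ⟨Submodule.smul_mem _ c (hv i).1, fun h => (hv i).2 fun h1 => h ?_⟩
    rw [Finsupp.smul_apply, h1, smul_zero]

open Classical in
/-- The element of `Λ` by which the differential multiplies (on the right) the component at `vtx i`
on its way to the right neighbour `vtx (i - 1)`: the letter between them if it is direct, and zero if
it is inverse or absent. -/
def toRight (w : GWord V E) (i : ℤ) : PathAlgebra k Q ⧸ I :=
  if i ∈ w.dom ∧ i - 1 ∈ w.dom then
    match w.letter (i - 1) with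
    | .dir p => pathElt I p
    | .inv _ => 0
  else 0

open Classical in
/-- The element of `Λ` by which the differential multiplies (on the right) the component at `vtx i`
on its way to the left neighbour `vtx (i + 1)`: the path `p` if the letter between them is inverse,
equal to `p⁻¹`, and zero if it is direct or absent. -/
def toLeft (w : GWord V E) (i : ℤ) : PathAlgebra k Q ⧸ I :=
  if i ∈ w.dom ∧ i + 1 ∈ w.dom then
    match w.letter i with
    | .dir _ => 0
    | .inv p => pathElt I p
  else 0

/-- The differential on the sum of all `Λ`: it sends `u` at position `i` to
`u * toRight i` at position `i - 1` plus `u * toLeft i` at position `i + 1`. -/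
def diff (w : GWord V E) :
    (ℤ →₀ PathAlgebra k Q ⧸ I) →ₗ[PathAlgebra k Q ⧸ I] (ℤ →₀ PathAlgebra k Q ⧸ I) :=
  Finsupp.lsum ℕ fun i =>
    Finsupp.lsingle (i - 1) ∘ₗ LinearMap.toSpanSingleton _ _ (toRight I w i) +
      Finsupp.lsingle (i + 1) ∘ₗ LinearMap.toSpanSingleton _ _ (toLeft I w i)

theorem ofArrows_append (p q : List E) :
    ofArrows k Q (p ++ q) = ofArrows k Q p * ofArrows k Q q := by
  simp [PathAlgebra.ofArrows]

theorem pathElt_append (p q : List E) : pathElt I (p ++ q) = pathElt I p * pathElt I q := by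
  simp [pathElt, ofArrows_append]

theorem pathElt_eq_zero {p : List E} : pathElt I p = 0 ↔ ofArrows k Q p ∈ I :=
  Ideal.Quotient.eq_zero_iff_mem

theorem ofArrows_mul_triv {p : List E} : ∀ {y x : V}, p ≠ [] → Q.IsPath y p x →
    ofArrows k Q p * basis (QPath.triv Q x) = ofArrows k Q p := by
  induction p with
  | nil => intro y x h; exact absurd rfl h
  | cons a l ih =>
    intro y x _ hp
    change ofArrows k Q ([a] ++ l) * _ = ofArrows k Q ([a] ++ l)
    rw [ofArrows_append, mul_assoc]
    cases l with
    | nil =>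
      have hx : Q.s a = x := hp.2
      subst hx
      have h1 : ofArrows k Q ([] : List E) = 1 := by simp [PathAlgebra.ofArrows]
      have h2 : ofArrows k Q [a] = basis (QPath.arrow Q a) := by simp [PathAlgebra.ofArrows]
      rw [h1, one_mul, mul_one, h2, PathAlgebra.basis_mul_basis, PathAlgebra.mulBasis,
        dif_pos (show (QPath.arrow Q a).src = (QPath.triv Q (Q.s a)).tgt from rfl)]
      rfl
    | cons b l => rw [ih (List.cons_ne_nil b l) hp.2]

theorem mul_pathElt_mem {p : List E} {y x : V} (hp : IsNontrivialPath Q I y p x)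
    (u : PathAlgebra k Q ⧸ I) : u * pathElt I p ∈ proj I x := by
  refine Submodule.mem_span_singleton.2 ⟨u * pathElt I p, ?_⟩
  rw [smul_eq_mul, mul_assoc]
  congr 1
  rw [pathElt, ← map_mul, ofArrows_mul_triv hp.1 hp.2.1]

theorem pathElt_mul_eq_zero {p q : List E} (hp : p ≠ []) (hq : q ≠ [])
    (h : ∀ a ∈ p.getLast?, ∀ b ∈ q.head?, ofArrows k Q [a, b] ∈ I) :
    pathElt I p * pathElt I q = 0 := by
  obtain ⟨p', a, rfl⟩ := List.eq_nil_or_concat p |>.resolve_left hp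
  obtain ⟨b, q', rfl⟩ := List.exists_cons_of_ne_nil hq
  have h0 : pathElt I [a, b] = 0 := (pathElt_eq_zero I).2 (h a (by simp) b (by simp))
  have h1 : p'.concat a ++ b :: q' = p' ++ ([a, b] ++ q') := by simp
  rw [← pathElt_append, h1, pathElt_append, pathElt_append, h0, zero_mul, mul_zero]

theorem diff_single (w : GWord V E) (i : ℤ) (u : PathAlgebra k Q ⧸ I) :
    diff I w (Finsupp.single i u) =
      Finsupp.single (i - 1) (u * toRight I w i) + Finsupp.single (i + 1) (u * toLeft I w i) := by
  simp [diff]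

theorem single_mem_term {w : GWord V E} {n i : ℤ} {u : PathAlgebra k Q ⧸ I}
    (h : u ∈ proj I (w.vtx i)) (h' : u ≠ 0 → i ∈ w.dom ∧ w.deg i = n) :
    Finsupp.single i u ∈ term I w n := by
  intro j
  by_cases hj : i = j
  · subst hj; simpa using ⟨h, h'⟩
  · rw [Finsupp.single_eq_of_ne (Ne.symm hj)]; exact ⟨zero_mem _, fun h => absurd rfl h⟩

theorem toRight_cases {w : GWord V E} (hw : IsHomotopyString Q I w) (i : ℤ) :
    toRight I w i = 0 ∨ ∃ p, i ∈ w.dom ∧ i - 1 ∈ w.dom ∧ w.letter (i - 1) = .dir p ∧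
      toRight I w i = pathElt I p ∧ IsNontrivialPath Q I (w.vtx i) p (w.vtx (i - 1)) ∧
      w.deg (i - 1) = w.deg i + 1 := by
  by_cases h : i ∈ w.dom ∧ i - 1 ∈ w.dom
  · have hl := hw.letters (i - 1) (by simpa using h.1) h.2
    rw [sub_add_cancel] at hl
    cases hc : w.letter (i - 1) with
    | dir p =>
      rw [hc] at hl
      exact Or.inr ⟨p, h.1, h.2, rfl, by simp [toRight, h, hc], hl.1, hl.2⟩
    | inv p => exact Or.inl (by simp [toRight, hc])
  · exact Or.inl (by rw [toRight, if_neg h])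

theorem toLeft_cases {w : GWord V E} (hw : IsHomotopyString Q I w) (i : ℤ) :
    toLeft I w i = 0 ∨ ∃ p, i ∈ w.dom ∧ i + 1 ∈ w.dom ∧ w.letter i = .inv p ∧
      toLeft I w i = pathElt I p ∧ IsNontrivialPath Q I (w.vtx i) p (w.vtx (i + 1)) ∧
      w.deg (i + 1) = w.deg i + 1 := by
  by_cases h : i ∈ w.dom ∧ i + 1 ∈ w.dom
  · have hl := hw.letters i h.2 h.1
    cases hc : w.letter i with
    | dir p => exact Or.inl (by simp [toLeft, hc])
    | inv p =>
      rw [hc] at hl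
      exact Or.inr ⟨p, h.1, h.2, rfl, by simp [toLeft, h, hc], hl.1, hl.2⟩
  · exact Or.inl (by rw [toLeft, if_neg h])

theorem diff_mem {w : GWord V E} (hw : IsHomotopyString Q I w) {n m : ℤ} (hnm : n + 1 = m)
    (v : ℤ →₀ PathAlgebra k Q ⧸ I) (hv : v ∈ term I w n) : diff I w v ∈ term I w m := by
  subst hnm
  rw [← Finsupp.sum_single v, Finsupp.sum, map_sum]
  refine sum_mem fun i hi => ?_
  have hd := ((hv i).2 (Finsupp.mem_support_iff.1 hi)).2
  rw [diff_single]
  refine add_mem ?_ ?_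
  · rcases toRight_cases I hw i with h | ⟨p, -, h1, -, h2, h3, h4⟩
    · rw [h, mul_zero, Finsupp.single_zero]; exact zero_mem _
    · rw [h2]
      exact single_mem_term I (mul_pathElt_mem I h3 _) fun _ => ⟨h1, by rw [h4, hd]⟩
  · rcases toLeft_cases I hw i with h | ⟨p, -, h1, -, h2, h3, h4⟩
    · rw [h, mul_zero, Finsupp.single_zero]; exact zero_mem _
    · rw [h2]
      exact single_mem_term I (mul_pathElt_mem I h3 _) fun _ => ⟨h1, by rw [h4, hd]⟩

theorem diff_diff {w : GWord V E} (hw : IsHomotopyString Q I w) (v : ℤ →₀ PathAlgebra k Q ⧸ I) :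
    diff I w (diff I w v) = 0 := by
  have hrr : ∀ i, toRight I w i * toRight I w (i - 1) = 0 := by
    intro i
    rcases toRight_cases I hw i with h | ⟨p, a1, a2, a3, a4, a5, -⟩
    · rw [h, zero_mul]
    rcases toRight_cases I hw (i - 1) with h | ⟨q, b1, b2, b3, b4, b5, -⟩
    · rw [h, mul_zero]
    have hj := hw.junctions (i - 1 - 1) (by simpa using a1) (by simpa using a2) b2
    rw [sub_add_cancel, a3, b3] at hj
    rw [a4, b4]
    exact pathElt_mul_eq_zero I a5.1 b5.1 hj
  have hll : ∀ i, toLeft I w i * toLeft I w (i + 1) = 0 := by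
    intro i
    rcases toLeft_cases I hw i with h | ⟨p, a1, a2, a3, a4, a5, -⟩
    · rw [h, zero_mul]
    rcases toLeft_cases I hw (i + 1) with h | ⟨q, b1, b2, b3, b4, b5, -⟩
    · rw [h, mul_zero]
    have hj := hw.junctions i b2 a2 a1
    rw [a3, b3] at hj
    rw [a4, b4]
    exact pathElt_mul_eq_zero I a5.1 b5.1 hj
  have hrl : ∀ i, toRight I w i * toLeft I w (i - 1) = 0 := by
    intro i
    rcases toRight_cases I hw i with h | ⟨p, -, -, a3, -⟩
    · rw [h, zero_mul]
    rcases toLeft_cases I hw (i - 1) with h | ⟨q, -, -, b3, -⟩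
    · rw [h, mul_zero]
    rw [a3] at b3; cases b3
  have hlr : ∀ i, toLeft I w i * toRight I w (i + 1) = 0 := by
    intro i
    rcases toLeft_cases I hw i with h | ⟨p, -, -, a3, -⟩
    · rw [h, zero_mul]
    rcases toRight_cases I hw (i + 1) with h | ⟨q, -, -, b3, -⟩
    · rw [h, mul_zero]
    rw [add_sub_cancel_right, a3] at b3; cases b3
  induction v using Finsupp.induction_linear with
  | zero => simp
  | add u v hu hv => rw [map_add, map_add, hu, hv, add_zero]
  | single i u =>
    rw [diff_single, map_add, diff_single, diff_single]
    simp only [mul_assoc, hrr, hll, hrl, hlr, mul_zero, Finsupp.single_zero, add_zero]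

/-- The string complex `P_w` of a homotopy string `w`, a complex of left modules over
`Λ = kQ / I`; it is the zero complex for `w = ∅`. -/
def stringComplex (w : GWord V E) (hw : IsHomotopyString Q I w) :
    CochainComplex (ModuleCat (PathAlgebra k Q ⧸ I)) ℤ where
  X n := ModuleCat.of _ (term I w n)
  d n m := if h : n + 1 = m then ModuleCat.ofHom ((diff I w).restrict (diff_mem I hw h)) else 0
  shape n m h := dif_neg h
  d_comp_d' n m l h h' := by
    rw [dif_pos (show n + 1 = m from h), dif_pos (show m + 1 = l from h')]
    exact ModuleCat.hom_ext (LinearMap.ext fun v => Subtype.ext (diff_diff I hw v.1))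

/-- The conditions under which a nontrivial path `f` is the single component, from `vtx 0` of `σ` to
`vtx 0` of `τ`, of a single map from `P_σ` to `P_τ`. The letters next to the component are
`σ_L = σ.letter 0`, `σ_R = σ.letter (-1)`, `τ_L = τ.letter 0` and `τ_R = τ.letter (-1)`; they are
empty if `1 ∈ σ.dom`, `-1 ∈ σ.dom`, `1 ∈ τ.dom` and `-1 ∈ τ.dom` fail, respectively. -/
structure IsSingleMap (σ τ : GWord V E) (f : List E) : Prop where
  mem_source : 0 ∈ σ.dom
  mem_target : 0 ∈ τ.dom
  deg_eq : σ.deg 0 = τ.deg 0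
  path : IsNontrivialPath Q I (σ.vtx 0) f (τ.vtx 0)
  L1 : 1 ∈ σ.dom → ∀ p, σ.letter 0 = .dir p → ofArrows k Q (p ++ f) ∈ I
  L2 : 1 ∈ τ.dom → ∀ p, τ.letter 0 = .inv p → ofArrows k Q (f ++ p) ∈ I
  R1 : -1 ∈ σ.dom → ∀ p, σ.letter (-1) = .inv p → ofArrows k Q (p ++ f) ∈ I
  R2 : -1 ∈ τ.dom → ∀ p, τ.letter (-1) = .dir p → ofArrows k Q (f ++ p) ∈ I

/-- Right multiplication by `f` from position `0` to position `0`. -/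
def singleTotal (f : List E) :
    (ℤ →₀ PathAlgebra k Q ⧸ I) →ₗ[PathAlgebra k Q ⧸ I] (ℤ →₀ PathAlgebra k Q ⧸ I) :=
  Finsupp.lsingle 0 ∘ₗ LinearMap.toSpanSingleton _ _ (pathElt I f) ∘ₗ Finsupp.lapply 0

theorem singleTotal_apply (f : List E) (v : ℤ →₀ PathAlgebra k Q ⧸ I) :
    singleTotal I f v = Finsupp.single 0 (v 0 * pathElt I f) := by
  simp [singleTotal]

theorem singleTotal_mem {σ τ : GWord V E} {f : List E} (h : IsSingleMap I σ τ f) (n : ℤ)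
    (v : ℤ →₀ PathAlgebra k Q ⧸ I) (hv : v ∈ term I σ n) : singleTotal I f v ∈ term I τ n := by
  rw [singleTotal_apply]
  refine single_mem_term I (mul_pathElt_mem I h.path _) fun h0 => ⟨h.mem_target, ?_⟩
  rw [← h.deg_eq]
  exact ((hv 0).2 fun h1 => h0 (by rw [h1, zero_mul])).2

theorem diff_singleTotal {σ τ : GWord V E} {f : List E} (h : IsSingleMap I σ τ f)
    (hτ : IsHomotopyString Q I τ) (v : ℤ →₀ PathAlgebra k Q ⧸ I) :
    diff I τ (singleTotal I f v) = 0 := by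
  have h1 : pathElt I f * toRight I τ 0 = 0 := by
    rcases toRight_cases I hτ 0 with h0 | ⟨p, -, a2, a3, a4, -⟩
    · rw [h0, mul_zero]
    · rw [a4, ← pathElt_append]
      exact (pathElt_eq_zero I).2 (h.R2 (by simpa using a2) p (by simpa using a3))
  have h2 : pathElt I f * toLeft I τ 0 = 0 := by
    rcases toLeft_cases I hτ 0 with h0 | ⟨p, -, a2, a3, a4, -⟩
    · rw [h0, mul_zero]
    · rw [a4, ← pathElt_append]
      exact (pathElt_eq_zero I).2 (h.L2 (by simpa using a2) p a3)
  rw [singleTotal_apply, diff_single, mul_assoc, mul_assoc, h1, h2]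
  simp

theorem singleTotal_diff {σ τ : GWord V E} {f : List E} (h : IsSingleMap I σ τ f)
    (hσ : IsHomotopyString Q I σ) (v : ℤ →₀ PathAlgebra k Q ⧸ I) :
    singleTotal I f (diff I σ v) = 0 := by
  have h1 : toRight I σ 1 * pathElt I f = 0 := by
    rcases toRight_cases I hσ 1 with h0 | ⟨p, a1, -, a3, a4, -⟩
    · rw [h0, zero_mul]
    · rw [a4, ← pathElt_append]
      exact (pathElt_eq_zero I).2 (h.L1 a1 p (by simpa using a3))
  have h2 : toLeft I σ (-1) * pathElt I f = 0 := by
    rcases toLeft_cases I hσ (-1) with h0 | ⟨p, a1, -, a3, a4, -⟩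
    · rw [h0, zero_mul]
    · rw [a4, ← pathElt_append]
      exact (pathElt_eq_zero I).2 (h.R1 a1 p a3)
  induction v using Finsupp.induction_linear with
  | zero => simp
  | add u v hu hv => rw [map_add, map_add, hu, hv, add_zero]
  | single i u =>
    rw [diff_single, map_add, singleTotal_apply, singleTotal_apply]
    have e1 : Finsupp.single (i - 1) (u * toRight I σ i) 0 * pathElt I f = 0 := by
      by_cases hi : i = 1
      · subst hi; simp [mul_assoc, h1]
      · rw [Finsupp.single_eq_of_ne (by lia), zero_mul]
    have e2 : Finsupp.single (i + 1) (u * toLeft I σ i) 0 * pathElt I f = 0 := by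
      by_cases hi : i = -1
      · subst hi; simp [mul_assoc, h2]
      · rw [Finsupp.single_eq_of_ne (by lia), zero_mul]
    rw [e1, e2]; simp

/-- The single map `P_σ → P_τ` with single component `f` from `vtx 0` of `σ` to `vtx 0` of `τ`. -/
def singleMap {σ τ : GWord V E} {f : List E} (hσ : IsHomotopyString Q I σ)
    (hτ : IsHomotopyString Q I τ) (h : IsSingleMap I σ τ f) :
    stringComplex I σ hσ ⟶ stringComplex I τ hτ where
  f n := ModuleCat.ofHom ((singleTotal I f).restrict (singleTotal_mem I h n))
  comm' n m hnm := by
    have hnm' : n + 1 = m := hnm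
    simp only [stringComplex, dif_pos hnm']
    exact ModuleCat.hom_ext (LinearMap.ext fun v =>
      Subtype.ext ((diff_singleTotal I h hτ v.1).trans (singleTotal_diff I h hσ v.1).symm))

/-- `σ` and `τ` are compatibly oriented for the single map with component `f`, where `f_R` and `f_L`
are the paths with `σ_R = f f_R` and `τ_R = f⁻¹ f_L⁻¹`. Containment of subletters is understood at the
end where `f` is attached. If `σ_L = p⁻¹` is inverse then `p` and `f` are both maps out of the source
of `f`, and `σ_L` contains `f` if `f` is an initial segment of `p`. If `τ_L = p` is direct then `p` and
`f` are both maps into the target of `f`, and `τ_L` contains `f` if `f` is a final segment of `p`. -/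
structure IsCompatiblyOriented (σ τ : GWord V E) (f fL fR : List E) : Prop where
  not_sub_left : 1 ∈ σ.dom → ∀ p, σ.letter 0 = .inv p → ¬ f <+: p
  not_sub_right : 1 ∈ τ.dom → ∀ p, τ.letter 0 = .dir p → ¬ f <:+ p
  zero_left : 1 ∈ σ.dom → ∀ p, σ.letter 0 = .dir p → ofArrows k Q (p ++ f) ∈ I
  zero_right : 1 ∈ τ.dom → ∀ p, τ.letter 0 = .inv p → ofArrows k Q (f ++ p) ∈ I
  source_eq : -1 ∈ σ.dom → σ.letter (-1) = .dir (f ++ fR)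
  target_eq : -1 ∈ τ.dom → τ.letter (-1) = .inv (fL ++ f)

/-- The single map with component `f` is a singleton single map, drawn in the compatible orientation:
`f_R` and `f_L` are nontrivial (when `σ_R`, respectively `τ_R`, is nonempty), and neither of `f` and
`σ_L`, and neither of `f` and `τ_L`, contains the other as a subletter. -/
structure IsSingletonSingleMap (σ τ : GWord V E) (f fL fR : List E) : Prop extends
    IsSingleMap I σ τ f, IsCompatiblyOriented I σ τ f fL fR where
  source_ne : -1 ∈ σ.dom → fR ≠ []
  target_ne : -1 ∈ τ.dom → fL ≠ []
  not_sub_left' : 1 ∈ σ.dom → ∀ p, σ.letter 0 = .inv p → ¬ p <+: f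
  not_sub_right' : 1 ∈ τ.dom → ∀ p, τ.letter 0 = .dir p → ¬ p <:+ f

end

/-! ### The strings describing the mapping cone -/

/-- The inverse `w⁻¹` of a string, drawn with `vtx i` of `w` as vertex `-1 - i` of `w⁻¹`. -/
def GWord.bar (w : GWord V E) : GWord V E where
  dom := {i | -1 - i ∈ w.dom}
  vtx i := w.vtx (-1 - i)
  letter i := (w.letter (-2 - i)).bar
  deg i := w.deg (-1 - i)

/-- The string `w` with all cohomological degrees lowered by one; its string complex is, up to the
sign of the differential, the shift of the string complex of `w`. -/
def GWord.shift (w : GWord V E) : GWord V E where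
  dom := w.dom
  vtx := w.vtx
  letter := w.letter
  deg i := w.deg i - 1

/-- The part of `u` on the vertices with index `≥ 0` on the left, the part of `w` on the vertices with
index `< 0` on the right, and the letter `l` between vertex `0` of `u` and vertex `-1` of `w` (if both
are present). If one of the two parts is empty, this is the other part, without `l`. -/
def GWord.glue (u : GWord V E) (l : Letter E) (w : GWord V E) : GWord V E where
  dom := {i | if 0 ≤ i then i ∈ u.dom else i ∈ w.dom}
  vtx i := if 0 ≤ i then u.vtx i else w.vtx i
  letter i := if 0 ≤ i then u.letter i else if i = -1 then l else w.letter i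
  deg i := if 0 ≤ i then u.deg i else w.deg i

/-- For `σ = β σ_L σ_R α` and `τ = δ τ_L τ_R γ`, where vertex `0` is the right end of `σ_L` and of
`τ_L`, this is the string `c₁ = β σ_L f τ_L⁻¹ δ⁻¹`. The part `β σ_L` or `τ_L⁻¹ δ⁻¹` is a trivial
string and contributes no letter if `σ_L`, respectively `τ_L`, is empty. -/
def coneString₁ (σ τ : GWord V E) (f : List E) : GWord V E :=
  σ.shift.glue (.dir f) τ.bar

/-- For `σ = β σ_L σ_R α` and `τ = δ τ_L τ_R γ` with `σ_R = f f_R` and `τ_R = f⁻¹ f_L⁻¹`, this is the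
string `c₂`, equal to `γ⁻¹ f_L f f_R α` if `σ_R` and `τ_R` are nonempty, to `α` if only `σ_R` is
nonempty, to `γ⁻¹` if only `τ_R` is nonempty, and to `∅` if both are empty. Here `γ⁻¹` consists of
the vertices of `τ` with index `≤ -1` and `α` of the vertices of `σ` with index `≤ -1`; each of them is
a trivial string if it has one vertex. -/
def coneString₂ (σ τ : GWord V E) (f fL fR : List E) : GWord V E :=
  τ.bar.glue (.dir (fL ++ f ++ fR)) σ.shift

end GentleCone

end

/-!
The mapping cone has the terms `P_σ[1] ⊕ P_τ`, and around the component `f` its unfolded diagram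
consists of the three maps `f : σ₀ → τ₀`, `-f f_R : σ₀ → σ₋₁` and `f_L f : τ₋₁ → τ₀`, where indices
denote the vertices of `σ` and `τ`. Subtracting `f_R` times the basis element of `σ₋₁` from that of
`τ₀`, and `f_L` times the basis element of `σ₀` from that of `τ₋₁`, up to signs, is an invertible
change of basis, after which the diagram falls apart into `f : σ₀ → τ₀` and
`f_L f f_R : τ₋₁ → σ₋₁`. These are the middle letters of `c₁` and `c₂`. Multiplying the basis element
of `σᵢ` by `(-1) ^ i` removes the signs of the shift, because the differential changes the parity of
`i`.

The change of basis could only create further maps at the neighbours of the four vertices. They are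
the products of `f_L` or `f_R` with a neighbouring letter, and all of them vanish: two by the junction
conditions of `σ` and `τ`, and the other two because `f_L f` and `f f_R` are nonzero while `σ_L` and
`τ_L` branch off from `f`, so that gentleness forces the arrows that meet to compose to zero
(`IsSingletonSingleMap.basisChange`). That neither of two nonzero paths contains the other as an
initial segment means in a gentle algebra that their first arrows differ (`IsGentle.head_ne`).

That `c₁` and `c₂` are homotopy strings rests on `IsGentle.not_mem_of_isChain`: as the ideal is
generated by products of two arrows, a path is nonzero as soon as the products of its consecutive
arrows are. Hence `f_L f f_R` is nonzero, and a zero product `σ_L f` is zero already at the two arrows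
that meet.
-/

noncomputable section

namespace GentleCone

open PathAlgebra (basis ofArrows)

/-! ### Paths and the monomial ideal -/

section

variable {k V E : Type*} {Q : Quiv V E}

theorem Quiv.IsPath.exists_of_append {p q : List E} :
    ∀ {z x : V}, Q.IsPath z (p ++ q) x → ∃ y, Q.IsPath z p y ∧ Q.IsPath y q x := by
  induction p with
  | nil => intro z x h; exact ⟨z, rfl, h⟩
  | cons a l ih => intro z x h; obtain ⟨y, h1, h2⟩ := ih h.2; exact ⟨y, ⟨h.1, h1⟩, h2⟩

theorem Quiv.IsPath.tgt_unique {p : List E} (hp : p ≠ []) {y y' x x' : V}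
    (h : Q.IsPath y p x) (h' : Q.IsPath y' p x') : y = y' := by
  cases p with
  | nil => exact absurd rfl hp
  | cons a l => exact h.1.symm.trans h'.1

theorem Quiv.IsPath.src_unique {p : List E} (hp : p ≠ []) {y y' x x' : V}
    (h : Q.IsPath y p x) (h' : Q.IsPath y' p x') : x = x' := by
  induction p generalizing y y' with
  | nil => exact absurd rfl hp
  | cons a l ih =>
    cases l with
    | nil => exact (show Q.s a = x from h.2).symm.trans h'.2
    | cons b l => exact ih (List.cons_ne_nil b l) h.2 h'.2

variable [Field k] [Fintype V]

theorem ofArrows_eq_basis {p : List E} (hp : p ≠ []) {y x : V} (h : Q.IsPath y p x) :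
    ofArrows k Q p = basis ⟨y, p, x, h⟩ := by
  induction p generalizing y with
  | nil => exact absurd rfl hp
  | cons a l ih =>
    obtain ⟨rfl, h2⟩ := h
    have ha : ofArrows k Q [a] = basis (QPath.arrow Q a) := by simp [PathAlgebra.ofArrows]
    cases l with
    | nil => obtain rfl : Q.s a = x := h2; exact ha
    | cons b l =>
      change ofArrows k Q ([a] ++ b :: l) = _
      rw [ofArrows_append, ih (List.cons_ne_nil b l) h2, ha, PathAlgebra.basis_mul_basis,
        PathAlgebra.mulBasis]
      exact dif_pos (show (QPath.arrow Q a).src = Q.s a from rfl)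

variable (I : Ideal (PathAlgebra k Q))

/-- The relation on arrows saying that the product `a b` does not lie in `I`. -/
def NonRel (a b : E) : Prop := ofArrows k Q [a, b] ∉ I

variable {I}

/-- An ideal generated by products of two arrows is spanned by the paths that contain one of the
generators, so every path in it has two consecutive arrows whose product lies in the ideal. -/
theorem IsGentle.not_isChain_of_mem (hI : IsGentle Q I) {p : QPath Q} (hp : basis p ∈ I) :
    ¬ p.arrows.IsChain (NonRel I) := by
  obtain ⟨R, hR, hIR⟩ := hI.quadratic_monomial
  set S : Set (QPath Q) := {q | ¬ q.arrows.IsChain (NonRel I)} with hS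
  -- `N` is the span of the paths that contain a zero product of two consecutive arrows; the two
  -- steps below show that it is a two-sided ideal.
  let N : Submodule k (PathAlgebra k Q) := Submodule.span k (basis '' S)
  have mulL (a u : PathAlgebra k Q) (hu : u ∈ N) : a * u ∈ N := by
    rw [PathAlgebra.mul_def]
    induction a using Finsupp.induction_linear with
    | zero => exact (LinearMap.map_zero₂ PathAlgebra.mulHom u).symm ▸ N.zero_mem
    | add a b ha hb =>
      exact (LinearMap.map_add₂ PathAlgebra.mulHom a b u).symm ▸ N.add_mem ha hb
    | single q c =>
      have hc : (Finsupp.single q c : QPath Q →₀ k) = c • (basis q : PathAlgebra k Q) :=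
        (Finsupp.smul_single_one q c).symm
      rw [hc, LinearMap.map_smul₂]
      refine N.smul_mem _ ?_
      induction hu using Submodule.span_induction with
      | zero => rw [map_zero]; exact N.zero_mem
      | add v w _ _ hv hw => rw [map_add]; exact N.add_mem hv hw
      | smul d v _ hv => rw [map_smul]; exact N.smul_mem _ hv
      | mem v hv =>
        obtain ⟨t, ht, rfl⟩ := hv
        rw [← PathAlgebra.mul_def, PathAlgebra.basis_mul_basis, PathAlgebra.mulBasis]
        split_ifs with h
        · exact Submodule.subset_span ⟨_, fun hc => ht (List.isChain_append.1 hc).2.1, rfl⟩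
        · exact N.zero_mem
  have mulR (a u : PathAlgebra k Q) (hu : u ∈ N) : u * a ∈ N := by
    rw [PathAlgebra.mul_def]
    induction a using Finsupp.induction_linear with
    | zero => exact (map_zero (PathAlgebra.mulHom u)).symm ▸ N.zero_mem
    | add a b ha hb => exact (map_add (PathAlgebra.mulHom u) a b).symm ▸ N.add_mem ha hb
    | single q c =>
      have hc : (Finsupp.single q c : QPath Q →₀ k) = c • (basis q : PathAlgebra k Q) :=
        (Finsupp.smul_single_one q c).symm
      rw [hc, map_smul]
      refine N.smul_mem _ ?_
      induction hu using Submodule.span_induction with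
      | zero => rw [LinearMap.map_zero₂]; exact N.zero_mem
      | add v w _ _ hv hw => rw [LinearMap.map_add₂]; exact N.add_mem hv hw
      | smul d v _ hv => rw [LinearMap.map_smul₂]; exact N.smul_mem _ hv
      | mem v hv =>
        obtain ⟨t, ht, rfl⟩ := hv
        rw [← PathAlgebra.mul_def, PathAlgebra.basis_mul_basis, PathAlgebra.mulBasis]
        split_ifs with h
        · exact Submodule.subset_span ⟨_, fun hc => ht (List.isChain_append.1 hc).1, rfl⟩
        · exact N.zero_mem
  have hN : ∀ u ∈ I, u ∈ N := by
    intro u hu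
    rw [hIR] at hu
    induction hu using Submodule.span_induction with
    | zero => exact N.zero_mem
    | add v w _ _ hv hw => exact N.add_mem hv hw
    | smul a v _ hv => exact mulL a v hv
    | mem v hv =>
      obtain ⟨v, w, r, hr, rfl⟩ := hv
      refine mulR _ _ (mulL _ _ (Submodule.subset_span ?_))
      have hpath : Q.IsPath (Q.e r.1) [r.1, r.2] (Q.s r.2) := ⟨rfl, (hR r hr).symm, rfl⟩
      refine ⟨⟨_, _, _, hpath⟩, fun hc => ?_, (ofArrows_eq_basis (by simp) hpath).symm⟩
      refine (List.isChain_pair.1 hc) ?_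
      rw [hIR]
      exact Submodule.subset_span ⟨1, 1, r, hr, by rw [one_mul, mul_one]⟩
  have hmem : (Finsupp.single p 1 : QPath Q →₀ k) ∈ Finsupp.supported k k S := by
    rw [Finsupp.supported_eq_span_single]
    exact hN _ hp
  exact hmem (by simp)

theorem isChain_of_not_mem [I.IsTwoSided] {p : List E} (hp : ofArrows k Q p ∉ I) :
    p.IsChain (NonRel I) := by
  rw [List.isChain_iff_forall_rel_of_append_cons_cons]
  rintro a b l₁ l₂ rfl h
  refine hp ?_
  rw [show l₁ ++ a :: b :: l₂ = l₁ ++ ([a, b] ++ l₂) by simp, ofArrows_append, ofArrows_append]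
  exact I.mul_mem_left _ (I.mul_mem_right _ h)

/-- A path is nonzero in `kQ / I` if the products of its consecutive arrows are. -/
theorem IsGentle.not_mem_of_isChain (hI : IsGentle Q I) {p : List E} (h0 : p ≠ []) {y x : V}
    (hp : Q.IsPath y p x) (h : p.IsChain (NonRel I)) : ofArrows k Q p ∉ I := by
  rw [ofArrows_eq_basis h0 hp]
  exact fun hm => hI.not_isChain_of_mem hm h

/-- If the product of two nonzero paths is zero, then already the product of the two arrows that
meet is zero. -/
theorem IsGentle.mem_of_append_mem (hI : IsGentle Q I) [I.IsTwoSided] {p q : List E} {z y x : V}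
    (hp : IsNontrivialPath Q I z p y) (hq : IsNontrivialPath Q I y q x)
    (h : ofArrows k Q (p ++ q) ∈ I) : ∀ a ∈ p.getLast?, ∀ b ∈ q.head?, ofArrows k Q [a, b] ∈ I := by
  intro a ha b hb
  by_contra hab
  refine hI.not_mem_of_isChain (by simp [hp.1]) (hp.2.1.append hq.2.1) ?_ h
  refine List.isChain_append.2 ⟨isChain_of_not_mem hp.2.2, isChain_of_not_mem hq.2.2, ?_⟩
  intro a' ha' b' hb'
  cases Option.mem_unique ha ha'
  cases Option.mem_unique hb hb'
  exact hab

/-- If nonzero paths `p q` and `q r` overlap in a nontrivial path `q`, then `p q r` is nonzero. -/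
theorem IsGentle.overlap (hI : IsGentle Q I) [I.IsTwoSided] {p q r : List E} (h0 : q ≠ [])
    {w z y x : V} (hp : Q.IsPath w p z) (hq : Q.IsPath z q y) (hr : Q.IsPath y r x)
    (hpq : ofArrows k Q (p ++ q) ∉ I) (hqr : ofArrows k Q (q ++ r) ∉ I) :
    ofArrows k Q (p ++ q ++ r) ∉ I := by
  refine hI.not_mem_of_isChain (by simp [h0]) ((hp.append hq).append hr) ?_
  have h1 := isChain_of_not_mem hpq
  have h2 := isChain_of_not_mem hqr
  rw [List.isChain_append] at h2
  refine List.isChain_append.2 ⟨h1, h2.2.1, fun a ha => h2.2.2 a ?_⟩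
  rwa [List.getLast?_append_of_ne_nil _ h0] at ha

/-- In a gentle algebra two nonzero paths with the same first (leftmost) arrow are comparable. -/
theorem IsGentle.prefix_or_prefix (hI : IsGentle Q I) {p q : List E} {a : E}
    (hp : (a :: p).IsChain (NonRel I)) (hq : (a :: q).IsChain (NonRel I)) :
    a :: p <+: a :: q ∨ a :: q <+: a :: p := by
  induction p generalizing a q with
  | nil => exact Or.inl (by simp)
  | cons b p ih =>
    cases q with
    | nil => exact Or.inr (by simp)
    | cons c q =>
      rw [List.isChain_cons_cons] at hp hq
      obtain rfl := hI.right_unique a b c hp.1 hq.1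
      simpa [List.cons_prefix_cons] using ih hp.2 hq.2

/-- The dual of `IsGentle.prefix_or_prefix`, for nonzero paths with the same last (rightmost)
arrow. The lists are reversed, so that this arrow comes first. -/
theorem IsGentle.prefix_or_prefix_reverse (hI : IsGentle Q I) {p q : List E} {a : E}
    (hp : (a :: p).IsChain (flip (NonRel I))) (hq : (a :: q).IsChain (flip (NonRel I))) :
    a :: p <+: a :: q ∨ a :: q <+: a :: p := by
  induction p generalizing a q with
  | nil => exact Or.inl (by simp)
  | cons b p ih =>
    cases q with
    | nil => exact Or.inr (by simp)
    | cons c q =>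
      rw [List.isChain_cons_cons] at hp hq
      obtain rfl := hI.left_unique a b c hp.1 hq.1
      simpa [List.cons_prefix_cons] using ih hp.2 hq.2

/-- Incomparability with respect to initial segments is decided by the first arrows. -/
theorem IsGentle.head_ne (hI : IsGentle Q I) [I.IsTwoSided] {p q : List E}
    (hp : ofArrows k Q p ∉ I) (hq : ofArrows k Q q ∉ I) (hpq : ¬ p <+: q) (hqp : ¬ q <+: p) :
    ∀ a ∈ p.head?, ∀ b ∈ q.head?, a ≠ b := by
  rintro a ha _ hb rfl
  obtain ⟨p, rfl⟩ := List.head?_eq_some_iff.1 ha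
  obtain ⟨q, rfl⟩ := List.head?_eq_some_iff.1 hb
  exact (hI.prefix_or_prefix (isChain_of_not_mem hp) (isChain_of_not_mem hq)).elim hpq hqp

/-- Incomparability with respect to final segments is decided by the last arrows. -/
theorem IsGentle.getLast_ne (hI : IsGentle Q I) [I.IsTwoSided] {p q : List E}
    (hp : ofArrows k Q p ∉ I) (hq : ofArrows k Q q ∉ I) (hpq : ¬ p <:+ q) (hqp : ¬ q <:+ p) :
    ∀ a ∈ p.getLast?, ∀ b ∈ q.getLast?, a ≠ b := by
  rintro a ha _ hb rfl
  rw [← List.reverse_prefix] at hpq hqp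
  have hp' := List.isChain_reverse.2 (isChain_of_not_mem hp)
  have hq' := List.isChain_reverse.2 (isChain_of_not_mem hq)
  rw [← List.head?_reverse] at ha hb
  obtain ⟨p', hp1⟩ := List.head?_eq_some_iff.1 ha
  obtain ⟨q', hq1⟩ := List.head?_eq_some_iff.1 hb
  rw [hp1] at hp' hpq hqp
  rw [hq1] at hq' hpq hqp
  exact (hI.prefix_or_prefix_reverse hp' hq').elim hpq hqp

/-- If `p q` is a nonzero path and `q'` does not start with the same (leftmost) arrow as `q`, then
`p q' = 0`. -/
theorem IsGentle.pathElt_mul_eq_zero_of_head_ne (hI : IsGentle Q I) [I.IsTwoSided]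
    {p q q' : List E} (hp : p ≠ []) (hq : q ≠ []) (hq' : q' ≠ [])
    (hpq : ofArrows k Q (p ++ q) ∉ I) (hne : ∀ a ∈ q.head?, ∀ b ∈ q'.head?, a ≠ b) :
    pathElt I p * pathElt I q' = 0 := by
  refine pathElt_mul_eq_zero I hp hq' fun a ha b hb => ?_
  by_contra hab
  obtain ⟨c, q, rfl⟩ := List.exists_cons_of_ne_nil hq
  have hac := (List.isChain_append.1 (isChain_of_not_mem hpq)).2.2 a ha c (by simp)
  exact hne c (by simp) b hb (hI.right_unique a c b hac hab)

/-- If `q p` is a nonzero path and `q'` does not end with the same (rightmost) arrow as `q`, then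
`q' p = 0`. -/
theorem IsGentle.pathElt_mul_eq_zero_of_getLast_ne (hI : IsGentle Q I) [I.IsTwoSided]
    {p q q' : List E} (hp : p ≠ []) (hq : q ≠ []) (hq' : q' ≠ [])
    (hqp : ofArrows k Q (q ++ p) ∉ I) (hne : ∀ a ∈ q.getLast?, ∀ b ∈ q'.getLast?, a ≠ b) :
    pathElt I q' * pathElt I p = 0 := by
  refine pathElt_mul_eq_zero I hq' hp fun b hb a ha => ?_
  by_contra hba
  have hc := List.getLast?_eq_some_getLast hq
  have hca := (List.isChain_append.1 (isChain_of_not_mem hqp)).2.2 _ hc a ha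
  exact hne _ hc b hb (hI.left_unique a _ b hca hba)

end

/-! ### Operations on homotopy strings -/

section

variable {V E : Type*} (u w : GWord V E) (l : Letter E)

theorem GWord.mem_glue_of_nonneg {i : ℤ} (hi : 0 ≤ i) : i ∈ (u.glue l w).dom ↔ i ∈ u.dom := by
  simp [GWord.glue, hi]

theorem GWord.mem_glue_of_neg {i : ℤ} (hi : i < 0) : i ∈ (u.glue l w).dom ↔ i ∈ w.dom := by
  simp [GWord.glue, hi.not_ge]

theorem GWord.glue_vtx_of_nonneg {i : ℤ} (hi : 0 ≤ i) : (u.glue l w).vtx i = u.vtx i := by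
  simp [GWord.glue, hi]

theorem GWord.glue_vtx_of_neg {i : ℤ} (hi : i < 0) : (u.glue l w).vtx i = w.vtx i := by
  simp [GWord.glue, hi.not_ge]

theorem GWord.glue_deg_of_nonneg {i : ℤ} (hi : 0 ≤ i) : (u.glue l w).deg i = u.deg i := by
  simp [GWord.glue, hi]

theorem GWord.glue_deg_of_neg {i : ℤ} (hi : i < 0) : (u.glue l w).deg i = w.deg i := by
  simp [GWord.glue, hi.not_ge]

theorem GWord.glue_letter_of_nonneg {i : ℤ} (hi : 0 ≤ i) :
    (u.glue l w).letter i = u.letter i := by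
  simp [GWord.glue, hi]

theorem GWord.glue_letter_neg_one : (u.glue l w).letter (-1) = l := by
  simp [GWord.glue]

theorem GWord.glue_letter_of_neg {i : ℤ} (hi : i < -1) : (u.glue l w).letter i = w.letter i := by
  have h : ¬ 0 ≤ i := by lia
  simp [GWord.glue, h, hi.ne]

end

section

variable {k V E : Type*} [Field k] [Fintype V] {Q : Quiv V E} {I : Ideal (PathAlgebra k Q)}

theorem IsLetter.bar {l : Letter E} {y x : V} {m n : ℤ} (h : IsLetter Q I l y m x n) :
    IsLetter Q I l.bar x n y m := by
  cases l <;> exact h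

theorem Junction.bar {l l' : Letter E} (h : Junction Q I l l') : Junction Q I l'.bar l.bar := by
  cases l <;> cases l'
  · exact h
  · exact fun a ha b hb => (h b hb a ha).symm
  · exact fun a ha b hb => (h b hb a ha).symm
  · exact h

theorem IsHomotopyString.shift {w : GWord V E} (h : IsHomotopyString Q I w) :
    IsHomotopyString Q I w.shift where
  interval := h.interval
  letters i h1 h0 := by
    have hl := h.letters i h1 h0
    change IsLetter Q I (w.letter i) (w.vtx (i + 1)) (w.deg (i + 1) - 1) (w.vtx i) (w.deg i - 1)
    cases hc : w.letter i <;> rw [hc] at hl <;> exact ⟨hl.1, by have := hl.2; lia⟩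
  junctions := h.junctions
  left_infinite := h.left_infinite
  right_infinite := h.right_infinite

theorem IsHomotopyString.bar {w : GWord V E} (h : IsHomotopyString Q I w) :
    IsHomotopyString Q I w.bar where
  interval := by
    refine ⟨fun x hx y hy z hz => ?_⟩
    exact h.interval.out hy hx ⟨by have := hz.2; lia, by have := hz.1; lia⟩
  letters i h1 h0 := by
    have e1 : -1 - (i + 1) = -2 - i := by ring
    have e0 : -1 - i = -2 - i + 1 := by ring
    change -1 - (i + 1) ∈ w.dom at h1
    change -1 - i ∈ w.dom at h0
    change IsLetter Q I _ (w.vtx (-1 - (i + 1))) (w.deg (-1 - (i + 1))) (w.vtx (-1 - i))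
      (w.deg (-1 - i))
    rw [e1] at h1
    rw [e0] at h0
    rw [e0, e1]
    exact (h.letters _ h0 h1).bar
  junctions i h2 h1 h0 := by
    have e2 : -1 - (i + 1 + 1) = -3 - i := by ring
    have e1 : -1 - (i + 1) = -3 - i + 1 := by ring
    have e0 : -1 - i = -3 - i + 1 + 1 := by ring
    change -1 - (i + 1 + 1) ∈ w.dom at h2
    change -1 - (i + 1) ∈ w.dom at h1
    change -1 - i ∈ w.dom at h0
    change Junction Q I (w.letter (-2 - (i + 1))).bar (w.letter (-2 - i)).bar
    rw [show -2 - (i + 1) = -3 - i by ring, show -2 - i = -3 - i + 1 by ring]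
    exact (h.junctions _ (e0 ▸ h0) (e1 ▸ h1) (e2 ▸ h2)).bar
  left_infinite hb := by
    have hb' : ¬ BddBelow w.dom := by
      rintro ⟨m, hm⟩
      exact hb ⟨-1 - m, fun i hi => by have := hm (show -1 - i ∈ w.dom from hi); lia⟩
    obtain ⟨m, hm⟩ := h.right_infinite hb'
    refine ⟨-2 - m, fun i hi h1 h0 => ?_⟩
    obtain ⟨a, ha⟩ := hm (-2 - i) (by lia)
      (by rw [show -2 - i + 1 = -1 - i by ring]; exact h0)
      (by rw [show -2 - i = -1 - (i + 1) by ring]; exact h1)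
    exact ⟨a, congrArg Letter.bar ha⟩
  right_infinite hb := by
    have hb' : ¬ BddAbove w.dom := by
      rintro ⟨m, hm⟩
      exact hb ⟨-1 - m, fun i hi => by have := hm (show -1 - i ∈ w.dom from hi); lia⟩
    obtain ⟨m, hm⟩ := h.left_infinite hb'
    refine ⟨-2 - m, fun i hi h1 h0 => ?_⟩
    obtain ⟨a, ha⟩ := hm (-2 - i) (by lia)
      (by rw [show -2 - i + 1 = -1 - i by ring]; exact h0)
      (by rw [show -2 - i = -1 - (i + 1) by ring]; exact h1)
    exact ⟨a, congrArg Letter.bar ha⟩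

/-- Gluing the nonnegative part of `u` to the negative part of `w` along a letter `l` gives a homotopy
string as soon as the new letter fits to its two neighbours. -/
theorem IsHomotopyString.glue {u w : GWord V E} {l : Letter E} (hu : IsHomotopyString Q I u)
    (hw : IsHomotopyString Q I w) (hu0 : ∀ i ∈ u.dom, 0 ≤ i → 0 ∈ u.dom)
    (hw0 : ∀ i ∈ w.dom, i < 0 → -1 ∈ w.dom)
    (hl : 0 ∈ u.dom → -1 ∈ w.dom →
      IsLetter Q I l (u.vtx 0) (u.deg 0) (w.vtx (-1)) (w.deg (-1)))
    (hul : 1 ∈ u.dom → 0 ∈ u.dom → -1 ∈ w.dom → Junction Q I (u.letter 0) l)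
    (hlw : 0 ∈ u.dom → -1 ∈ w.dom → -2 ∈ w.dom → Junction Q I l (w.letter (-2))) :
    IsHomotopyString Q I (u.glue l w) where
  interval := by
    refine ⟨fun x hx y hy z hz => ?_⟩
    rcases lt_or_ge z 0 with h0 | h0
    · have hx0 := hz.1.trans_lt h0
      rw [GWord.mem_glue_of_neg _ _ _ hx0] at hx
      exact (GWord.mem_glue_of_neg _ _ _ h0).2
        (hw.interval.out hx (hw0 x hx hx0) ⟨hz.1, by lia⟩)
    · have hy0 := h0.trans hz.2
      rw [GWord.mem_glue_of_nonneg _ _ _ hy0] at hy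
      exact (GWord.mem_glue_of_nonneg _ _ _ h0).2
        (hu.interval.out (hu0 y hy hy0) hy ⟨h0, hz.2⟩)
  letters i h1 h0 := by
    rcases lt_trichotomy i (-1) with hi | rfl | hi
    · have hi0 : i < 0 := by lia
      have hi1 : i + 1 < 0 := by lia
      simp only [GWord.mem_glue_of_neg, GWord.glue_vtx_of_neg, GWord.glue_deg_of_neg,
        GWord.glue_letter_of_neg, hi, hi0, hi1] at h1 h0 ⊢
      exact hw.letters i h1 h0
    · rw [GWord.glue_letter_neg_one]
      exact hl h1 h0
    · have hi0 : 0 ≤ i := by lia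
      have hi1 : 0 ≤ i + 1 := by lia
      simp only [GWord.mem_glue_of_nonneg, GWord.glue_vtx_of_nonneg, GWord.glue_deg_of_nonneg,
        GWord.glue_letter_of_nonneg, hi0, hi1] at h1 h0 ⊢
      exact hu.letters i h1 h0
  junctions i h2 h1 h0 := by
    rcases lt_or_ge i (-2) with hi | hi
    · have hi0 : i < -1 := by lia
      have hi1 : i + 1 < -1 := by lia
      rw [GWord.glue_letter_of_neg _ _ _ hi0, GWord.glue_letter_of_neg _ _ _ hi1]
      rw [GWord.mem_glue_of_neg _ _ _ (by lia)] at h2 h1 h0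
      exact hw.junctions i h2 h1 h0
    · rcases lt_or_ge i 0 with hi' | hi'
      · obtain rfl | rfl : i = -2 ∨ i = -1 := by lia
        · exact hlw h2 h1 h0
        · exact hul h2 h1 h0
      · rw [GWord.glue_letter_of_nonneg _ _ _ hi', GWord.glue_letter_of_nonneg _ _ _ (by lia)]
        rw [GWord.mem_glue_of_nonneg _ _ _ (by lia)] at h2 h1 h0
        exact hu.junctions i h2 h1 h0
  left_infinite hb := by
    have hb' : ¬ BddAbove u.dom := by
      rintro ⟨m, hm⟩
      refine hb ⟨max m 0, fun i hi => ?_⟩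
      rcases lt_or_ge i 0 with h0 | h0
      · exact le_max_of_le_right h0.le
      · exact le_max_of_le_left (hm ((GWord.mem_glue_of_nonneg _ _ _ h0).1 hi))
    obtain ⟨m, hm⟩ := hu.left_infinite hb'
    refine ⟨max m 0, fun i hi h1 h0 => ?_⟩
    have hi0 : 0 ≤ i := le_of_max_le_right hi
    rw [GWord.mem_glue_of_nonneg _ _ _ (by lia)] at h1 h0
    rw [GWord.glue_letter_of_nonneg _ _ _ hi0]
    exact hm i (le_of_max_le_left hi) h1 h0
  right_infinite hb := by
    have hb' : ¬ BddBelow w.dom := by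
      rintro ⟨m, hm⟩
      refine hb ⟨min m 0, fun i hi => ?_⟩
      rcases lt_or_ge i 0 with h0 | h0
      · exact min_le_of_left_le (hm ((GWord.mem_glue_of_neg _ _ _ h0).1 hi))
      · exact min_le_of_right_le h0
    obtain ⟨m, hm⟩ := hw.right_infinite hb'
    refine ⟨min m (-2), fun i hi h1 h0 => ?_⟩
    have hi0 : i ≤ -2 := hi.trans (min_le_right _ _)
    rw [GWord.mem_glue_of_neg _ _ _ (by lia)] at h1 h0
    rw [GWord.glue_letter_of_neg _ _ _ (by lia)]
    exact hm i (hi.trans (min_le_left _ _)) h1 h0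

/-! ### The maps of the unfolded diagram under the operations -/

variable (I) [I.IsTwoSided]

theorem toRight_bar (w : GWord V E) (i : ℤ) : toRight I w.bar i = toLeft I w (-1 - i) := by
  have h : (i ∈ w.bar.dom ∧ i - 1 ∈ w.bar.dom) ↔ (-1 - i ∈ w.dom ∧ -1 - i + 1 ∈ w.dom) := by
    rw [show -1 - i + 1 = -1 - (i - 1) by ring]; rfl
  have hl : w.bar.letter (i - 1) = (w.letter (-1 - i)).bar := by
    rw [show -1 - i = -2 - (i - 1) by ring]; rfl
  rw [toRight, toLeft, hl]
  classical
  refine if_congr h ?_ rfl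
  cases w.letter (-1 - i) <;> rfl

theorem toLeft_bar (w : GWord V E) (i : ℤ) : toLeft I w.bar i = toRight I w (-1 - i) := by
  have h : (i ∈ w.bar.dom ∧ i + 1 ∈ w.bar.dom) ↔ (-1 - i ∈ w.dom ∧ -1 - i - 1 ∈ w.dom) := by
    rw [show -1 - i - 1 = -1 - (i + 1) by ring]; rfl
  have hl : w.bar.letter i = (w.letter (-1 - i - 1)).bar := by
    rw [show -1 - i - 1 = -2 - i by ring]; rfl
  rw [toRight, toLeft, hl]
  classical
  refine if_congr h ?_ rfl
  cases w.letter (-1 - i - 1) <;> rfl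

variable (u w : GWord V E) (l : Letter E)

theorem toRight_glue_of_pos {i : ℤ} (hi : 0 < i) : toRight I (u.glue l w) i = toRight I u i := by
  rw [toRight, toRight, GWord.glue_letter_of_nonneg _ _ _ (by lia)]
  classical
  exact if_congr (and_congr (GWord.mem_glue_of_nonneg _ _ _ hi.le)
    (GWord.mem_glue_of_nonneg _ _ _ (by lia))) rfl rfl

theorem toRight_glue_of_neg {i : ℤ} (hi : i < 0) : toRight I (u.glue l w) i = toRight I w i := by
  rw [toRight, toRight, GWord.glue_letter_of_neg _ _ _ (by lia)]
  classical
  exact if_congr (and_congr (GWord.mem_glue_of_neg _ _ _ hi)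
    (GWord.mem_glue_of_neg _ _ _ (by lia))) rfl rfl

open Classical in
theorem toRight_glue_zero (p : List E) :
    toRight I (u.glue (.dir p) w) 0 = if 0 ∈ u.dom ∧ -1 ∈ w.dom then pathElt I p else 0 := by
  rw [toRight]
  rfl

theorem toLeft_glue_of_nonneg {i : ℤ} (hi : 0 ≤ i) : toLeft I (u.glue l w) i = toLeft I u i := by
  rw [toLeft, toLeft, GWord.glue_letter_of_nonneg _ _ _ hi]
  classical
  exact if_congr (and_congr (GWord.mem_glue_of_nonneg _ _ _ hi)
    (GWord.mem_glue_of_nonneg _ _ _ (by lia))) rfl rfl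

theorem toLeft_glue_of_neg {i : ℤ} (hi : i < -1) : toLeft I (u.glue l w) i = toLeft I w i := by
  rw [toLeft, toLeft, GWord.glue_letter_of_neg _ _ _ hi]
  classical
  exact if_congr (and_congr (GWord.mem_glue_of_neg _ _ _ (by lia))
    (GWord.mem_glue_of_neg _ _ _ (by lia))) rfl rfl

theorem toLeft_glue_neg_one (p : List E) : toLeft I (u.glue (.dir p) w) (-1) = 0 := by
  rw [toLeft, GWord.glue_letter_neg_one, ite_self]

end

/-! ### The change of basis over a ring -/

section

variable {A : Type*} [Ring A]

/-- The endomorphism of `⨁_{i ∈ ℤ} A` that sends `u` at position `i` to `u * R i` at position `i - 1`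
plus `u * L i` at position `i + 1`. -/
def walk (R L : ℤ → A) : (ℤ →₀ A) →ₗ[A] (ℤ →₀ A) :=
  Finsupp.lsum ℕ fun i =>
    Finsupp.lsingle (i - 1) ∘ₗ LinearMap.toSpanSingleton _ _ (R i) +
      Finsupp.lsingle (i + 1) ∘ₗ LinearMap.toSpanSingleton _ _ (L i)

theorem walk_single (R L : ℤ → A) (i : ℤ) (u : A) :
    walk R L (Finsupp.single i u) =
      Finsupp.single (i - 1) (u * R i) + Finsupp.single (i + 1) (u * L i) := by
  simp [walk]

/-- The sign `(-1) ^ i` in a ring. -/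
def sgn (A : Type*) [Ring A] (i : ℤ) : A := ((i.negOnePow : ℤ) : A)

theorem sgn_add_one (i : ℤ) : sgn A (i + 1) = - sgn A i := by simp [sgn, Int.negOnePow_succ]

theorem sgn_sub_one (i : ℤ) : sgn A (i - 1) = - sgn A i := by
  rw [← neg_eq_iff_eq_neg, ← sgn_add_one, sub_add_cancel]

@[simp] theorem sgn_zero : sgn A 0 = 1 := by simp [sgn]

@[simp] theorem sgn_neg_one : sgn A (-1) = -1 := by simp [sgn]

theorem sgn_mul_self (i : ℤ) : sgn A i * sgn A i = 1 := by
  rw [sgn, ← Int.cast_mul, ← Units.val_mul, ← sq, Int.units_sq]; simp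

theorem sgn_comm (i : ℤ) (u : A) : sgn A i * u = u * sgn A i := Int.cast_comm _ _

/-- The linear endomorphism of `⨁_{i ∈ ℤ} A` with prescribed values on the basis elements. -/
abbrev comb (g : ℤ → ℤ →₀ A) : (ℤ →₀ A) →ₗ[A] (ℤ →₀ A) := Finsupp.linearCombination A g

theorem hom_ext_single {M : Type*} [AddCommGroup M] [Module A M] {φ ψ : (ℤ →₀ A) →ₗ[A] M}
    (h : ∀ i, φ (Finsupp.single i 1) = ψ (Finsupp.single i 1)) : φ = ψ :=
  Finsupp.lhom_ext' fun i => LinearMap.ext_ring (h i)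

/-! The basis elements of the mapping cone are denoted by `s i` and `t j`, those of the two direct
summands by `x i` and `y i`. The isomorphism from the mapping cone sends
* `s i` to `(-1) ^ i * x i` for `i ≥ 0` and to `(-1) ^ i * y i` for `i < 0`,
* `t j` to `x (-1 - j)` for `j > 0` and to `-y (-1 - j)` for `j < -1`,
* `t 0` to `x (-1) - r * y (-1)`, and `t (-1)` to `-y 0 + l * x 0`.

The eight maps below are the entries of its matrix and of the matrix of its inverse; `S` and `T` refer
to the elements `s i` and `t j`, and `₁` and `₂` to the elements `x i` and `y i`. -/

variable (l r : A)

/-- The entry `s → x` of the isomorphism. -/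
def fwdS₁ : (ℤ →₀ A) →ₗ[A] (ℤ →₀ A) :=
  comb fun i => if 0 ≤ i then Finsupp.single i (sgn A i) else 0

/-- The entry `s → y` of the isomorphism. -/
def fwdS₂ : (ℤ →₀ A) →ₗ[A] (ℤ →₀ A) :=
  comb fun i => if 0 ≤ i then 0 else Finsupp.single i (sgn A i)

/-- The entry `t → x` of the isomorphism. -/
def fwdT₁ : (ℤ →₀ A) →ₗ[A] (ℤ →₀ A) :=
  comb fun j => if 0 ≤ j then Finsupp.single (-1 - j) 1 else
    if j = -1 then Finsupp.single 0 l else 0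

/-- The entry `t → y` of the isomorphism. -/
def fwdT₂ : (ℤ →₀ A) →ₗ[A] (ℤ →₀ A) :=
  comb fun j => if j = 0 then Finsupp.single (-1) (-r) else
    if 0 ≤ j then 0 else Finsupp.single (-1 - j) (-1)

/-- The entry `x → s` of the inverse. -/
def bwdS₁ : (ℤ →₀ A) →ₗ[A] (ℤ →₀ A) :=
  comb fun i => if 0 ≤ i then Finsupp.single i (sgn A i) else
    if i = -1 then Finsupp.single (-1) (-r) else 0

/-- The entry `y → s` of the inverse. -/
def bwdS₂ : (ℤ →₀ A) →ₗ[A] (ℤ →₀ A) :=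
  comb fun i => if i = 0 then Finsupp.single 0 l else
    if 0 ≤ i then 0 else Finsupp.single i (sgn A i)

/-- The entry `x → t` of the inverse. -/
def bwdT₁ : (ℤ →₀ A) →ₗ[A] (ℤ →₀ A) :=
  comb fun i => if 0 ≤ i then 0 else Finsupp.single (-1 - i) 1

/-- The entry `y → t` of the inverse. -/
def bwdT₂ : (ℤ →₀ A) →ₗ[A] (ℤ →₀ A) :=
  comb fun i => if 0 ≤ i then Finsupp.single (-1 - i) (-1) else 0

theorem bwd_fwd_SS (v : ℤ →₀ A) :
    bwdS₁ r (fwdS₁ v) + bwdS₂ l (fwdS₂ v) = v := by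
  suffices h : bwdS₁ r ∘ₗ fwdS₁ + bwdS₂ l ∘ₗ fwdS₂ = LinearMap.id from LinearMap.congr_fun h v
  refine hom_ext_single fun i => ?_
  by_cases h : 0 ≤ i
  · simp [fwdS₁, fwdS₂, bwdS₁, h, sgn_mul_self]
  · have h' : i ≠ 0 := by lia
    simp [fwdS₁, fwdS₂, bwdS₂, h, h', sgn_mul_self]

theorem bwd_fwd_ST (v : ℤ →₀ A) :
    bwdT₁ (fwdS₁ v) + bwdT₂ (fwdS₂ v) = 0 := by
  suffices h : bwdT₁ ∘ₗ fwdS₁ + bwdT₂ ∘ₗ fwdS₂ = (0 : (ℤ →₀ A) →ₗ[A] (ℤ →₀ A)) from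
    LinearMap.congr_fun h v
  refine hom_ext_single fun i => ?_
  by_cases h : 0 ≤ i <;> simp [fwdS₁, fwdS₂, bwdT₁, bwdT₂, h]

theorem bwd_fwd_TS (v : ℤ →₀ A) :
    bwdS₁ r (fwdT₁ l v) + bwdS₂ l (fwdT₂ r v) = 0 := by
  suffices h : bwdS₁ r ∘ₗ fwdT₁ l + bwdS₂ l ∘ₗ fwdT₂ r = 0 from LinearMap.congr_fun h v
  refine hom_ext_single fun j => ?_
  rcases lt_trichotomy j 0 with h | rfl | h
  · by_cases h1 : j = -1
    · subst h1; simp [fwdT₁, fwdT₂, bwdS₁, bwdS₂]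
    · have h2 : j ≤ -1 := by lia
      have h3 : -1 - j ≠ 0 := by lia
      simp [fwdT₁, fwdT₂, bwdS₂, h.ne, h.not_ge, h1, h2, h3]
  · simp [fwdT₁, fwdT₂, bwdS₁, bwdS₂]
  · have h2 : ¬ j ≤ -1 := by lia
    simp [fwdT₁, fwdT₂, bwdS₁, h.ne', h.le, h2]

theorem bwd_fwd_TT (v : ℤ →₀ A) :
    bwdT₁ (fwdT₁ l v) + bwdT₂ (fwdT₂ r v) = v := by
  suffices h : bwdT₁ ∘ₗ fwdT₁ l + bwdT₂ ∘ₗ fwdT₂ r = LinearMap.id from LinearMap.congr_fun h v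
  refine hom_ext_single fun j => ?_
  rcases lt_trichotomy j 0 with h | rfl | h
  · have h2 : j ≤ -1 := by lia
    by_cases h1 : j = -1
    · subst h1; simp [fwdT₁, fwdT₂, bwdT₁, bwdT₂]
    · simp [fwdT₁, fwdT₂, bwdT₂, h.ne, h.not_ge, h1, h2]
  · simp [fwdT₁, fwdT₂, bwdT₁, bwdT₂]
  · have h2 : ¬ j ≤ -1 := by lia
    simp [fwdT₁, fwdT₂, bwdT₁, h.ne', h.le, h2]

theorem fwd_bwd₁₁ (v : ℤ →₀ A) :
    fwdS₁ (bwdS₁ r v) + fwdT₁ l (bwdT₁ v) = v := by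
  suffices h : fwdS₁ ∘ₗ bwdS₁ r + fwdT₁ l ∘ₗ bwdT₁ = LinearMap.id from LinearMap.congr_fun h v
  refine hom_ext_single fun i => ?_
  by_cases h : 0 ≤ i
  · simp [fwdS₁, fwdT₁, bwdS₁, bwdT₁, h, sgn_mul_self]
  · have h2 : i ≤ -1 := by lia
    by_cases h1 : i = -1
    · subst h1; simp [fwdS₁, fwdT₁, bwdS₁, bwdT₁]
    · simp [fwdT₁, bwdS₁, bwdT₁, h, h1, h2]

theorem fwd_bwd₁₂ (v : ℤ →₀ A) :
    fwdS₂ (bwdS₁ r v) + fwdT₂ r (bwdT₁ v) = 0 := by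
  suffices h : fwdS₂ ∘ₗ bwdS₁ r + fwdT₂ r ∘ₗ bwdT₁ = 0 from LinearMap.congr_fun h v
  refine hom_ext_single fun i => ?_
  by_cases h : 0 ≤ i
  · simp [fwdS₂, bwdS₁, bwdT₁, h]
  · have h2 : i ≤ -1 := by lia
    by_cases h1 : i = -1
    · subst h1; simp [fwdS₂, fwdT₂, bwdS₁, bwdT₁]
    · have h3 : -1 - i ≠ 0 := by lia
      simp [fwdT₂, bwdS₁, bwdT₁, h, h1, h2, h3]

theorem fwd_bwd₂₁ (v : ℤ →₀ A) :
    fwdS₁ (bwdS₂ l v) + fwdT₁ l (bwdT₂ v) = 0 := by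
  suffices h : fwdS₁ ∘ₗ bwdS₂ l + fwdT₁ l ∘ₗ bwdT₂ = 0 from LinearMap.congr_fun h v
  refine hom_ext_single fun i => ?_
  by_cases h1 : i = 0
  · subst h1; simp [fwdS₁, fwdT₁, bwdS₂, bwdT₂]
  by_cases h : 0 ≤ i
  · have h2 : ¬ i ≤ -1 := by lia
    have h3 : -1 - i ≠ -1 := by lia
    simp [fwdT₁, bwdS₂, bwdT₂, h, h1, h2, h3]
  · simp [fwdS₁, bwdS₂, bwdT₂, h, h1]

theorem fwd_bwd₂₂ (v : ℤ →₀ A) :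
    fwdS₂ (bwdS₂ l v) + fwdT₂ r (bwdT₂ v) = v := by
  suffices h : fwdS₂ ∘ₗ bwdS₂ l + fwdT₂ r ∘ₗ bwdT₂ = LinearMap.id from LinearMap.congr_fun h v
  refine hom_ext_single fun i => ?_
  by_cases h1 : i = 0
  · subst h1; simp [fwdS₂, fwdT₂, bwdS₂, bwdT₂]
  by_cases h : 0 ≤ i
  · have h2 : ¬ i ≤ -1 := by lia
    have h3 : -1 - i ≠ 0 := by lia
    simp [fwdT₂, bwdS₂, bwdT₂, h, h1, h2, h3]
  · simp [fwdS₂, bwdS₂, bwdT₂, h, h1, sgn_mul_self]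

/-- The relations that make the change of basis compatible with the differentials. The pairs `(Rσ, Lσ)`
and `(Rτ, Lτ)` are the maps to the right and to the left neighbour in the unfolded diagrams of `σ` and
`τ`, the pairs `(R₁, L₁)` and `(R₂, L₂)` are those of the two strings describing the mapping cone, and
`φ`, `l`, `r` stand for the paths `f`, `f_L`, `f_R`. The first twelve fields say how the two strings
are assembled from `σ` and `τ`, the next four describe the letters `σ_R = f f_R` and
`τ_R = (f_L f)⁻¹`, and the last four are the zero relations at the vertices next to `f_L` and
`f_R`. -/
structure BasisChange (Rσ Lσ Rτ Lτ R₁ L₁ R₂ L₂ : ℤ → A) (φ l r : A) : Prop where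
  R₁_pos : ∀ i, 0 < i → R₁ i = Rσ i
  R₁_zero : R₁ 0 = φ
  R₁_neg : ∀ i, i < 0 → R₁ i = Lτ (-1 - i)
  L₁_nonneg : ∀ i, 0 ≤ i → L₁ i = Lσ i
  L₁_neg_one : L₁ (-1) = 0
  L₁_neg : ∀ i, i < -1 → L₁ i = Rτ (-1 - i)
  R₂_pos : ∀ i, 0 < i → R₂ i = Lτ (-1 - i)
  R₂_zero : R₂ 0 = l * φ * r
  R₂_neg : ∀ i, i < 0 → R₂ i = Rσ i
  L₂_nonneg : ∀ i, 0 ≤ i → L₂ i = Rτ (-1 - i)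
  L₂_neg_one : L₂ (-1) = 0
  L₂_neg : ∀ i, i < -1 → L₂ i = Lσ i
  Rσ_zero : Rσ 0 = φ * r
  Lσ_neg_one : Lσ (-1) = 0
  Rτ_zero : Rτ 0 = 0
  Lτ_neg_one : Lτ (-1) = l * φ
  l_mul : l * Lσ 0 = 0
  mul_r : Rτ 1 * r = 0
  mul_l : Lτ (-2) * l = 0
  r_mul : r * Rσ (-1) = 0

namespace BasisChange

variable {Rσ Lσ Rτ Lτ R₁ L₁ R₂ L₂ : ℤ → A} {φ l r : A}

/-- The component from `P_σ` to the first summand of the statement that the isomorphism commutes with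
the differentials; the sign of `walk Rσ Lσ` is that of the differential of a mapping cone. -/
theorem comm_S₁ (h : BasisChange Rσ Lσ Rτ Lτ R₁ L₁ R₂ L₂ φ l r) (v : ℤ →₀ A) :
    fwdT₁ l (Finsupp.single 0 (v 0 * φ)) - fwdS₁ (walk Rσ Lσ v) = walk R₁ L₁ (fwdS₁ v) := by
  suffices H : fwdT₁ l ∘ₗ Finsupp.lsingle 0 ∘ₗ LinearMap.toSpanSingleton _ _ φ ∘ₗ
      Finsupp.lapply 0 - fwdS₁ ∘ₗ walk Rσ Lσ = walk R₁ L₁ ∘ₗ fwdS₁ by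
    simpa using LinearMap.congr_fun H v
  refine hom_ext_single fun i => ?_
  rcases lt_trichotomy i 0 with hi | rfl | hi
  · have h1 : ¬ 1 ≤ i := by lia
    have h2 : ¬ 0 ≤ i := by lia
    by_cases h3 : i = -1
    · subst h3; simp [fwdS₁, walk_single, h.Lσ_neg_one]
    · have h4 : ¬ 0 ≤ i + 1 := by lia
      simp [fwdS₁, walk_single, h1, h2, h4, hi.ne]
  -- The map `φ` to `t 0` becomes the map from `x 0` to `x (-1)`.
  · simp [fwdS₁, fwdT₁, walk_single, h.R₁_zero, h.L₁_nonneg, sgn]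
  · have h1 : 1 ≤ i := by lia
    have h2 : 0 ≤ i + 1 := by lia
    simp [fwdS₁, walk_single, h1, h2, hi.le, hi.ne', h.R₁_pos i hi, h.L₁_nonneg i hi.le,
      sgn_comm, sgn_add_one, sgn_sub_one]
    abel

theorem comm_S₂ (h : BasisChange Rσ Lσ Rτ Lτ R₁ L₁ R₂ L₂ φ l r) (v : ℤ →₀ A) :
    fwdT₂ r (Finsupp.single 0 (v 0 * φ)) - fwdS₂ (walk Rσ Lσ v) = walk R₂ L₂ (fwdS₂ v) := by
  suffices H : fwdT₂ r ∘ₗ Finsupp.lsingle 0 ∘ₗ LinearMap.toSpanSingleton _ _ φ ∘ₗ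
      Finsupp.lapply 0 - fwdS₂ ∘ₗ walk Rσ Lσ = walk R₂ L₂ ∘ₗ fwdS₂ by
    simpa using LinearMap.congr_fun H v
  refine hom_ext_single fun i => ?_
  rcases lt_trichotomy i 0 with hi | rfl | hi
  · have h1 : ¬ 1 ≤ i := by lia
    have h2 : ¬ 0 ≤ i := by lia
    by_cases h3 : i = -1
    -- The summands do not interact because no map goes from `s (-1)` to `s 0`.
    · subst h3; simp [fwdS₂, walk_single, h.Lσ_neg_one, h.L₂_neg_one, h.R₂_neg, sgn]
    · have h4 : ¬ 0 ≤ i + 1 := by lia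
      have h5 : i < -1 := by lia
      simp [fwdS₂, walk_single, h1, h2, h4, hi.ne, h.R₂_neg i hi, h.L₂_neg i h5,
        sgn_comm, sgn_add_one, sgn_sub_one]
      abel
  -- The summand `-r * y (-1)` of the image of `t 0` cancels the map `φ * r` from `s 0` to `s (-1)`.
  · simp [fwdS₂, fwdT₂, walk_single, h.Rσ_zero, -Finsupp.single_mul]
  · have h1 : 1 ≤ i := by lia
    have h2 : 0 ≤ i + 1 := by lia
    simp [fwdS₂, walk_single, h1, h2, hi.le, hi.ne']

theorem comm_T₁ (h : BasisChange Rσ Lσ Rτ Lτ R₁ L₁ R₂ L₂ φ l r) (v : ℤ →₀ A) :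
    fwdT₁ l (walk Rτ Lτ v) = walk R₁ L₁ (fwdT₁ l v) := by
  suffices H : fwdT₁ l ∘ₗ walk Rτ Lτ = walk R₁ L₁ ∘ₗ fwdT₁ l from LinearMap.congr_fun H v
  refine hom_ext_single fun j => ?_
  rcases lt_trichotomy j 0 with hj | rfl | hj
  · have h1 : ¬ 1 ≤ j := by lia
    have h2 : ¬ 0 ≤ j := by lia
    by_cases h3 : j = -1
    · subst h3
      simp [fwdT₁, walk_single, h.Lτ_neg_one, h.R₁_zero, h.L₁_nonneg, h.l_mul, -Finsupp.single_mul]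
    · by_cases h4 : j = -2
      -- The summand `l * x 0` of the image of `t (-1)` is killed by the map from `t (-2)`.
      · subst h4; simp [fwdT₁, walk_single, h.mul_l]
      · have h5 : ¬ 0 ≤ j + 1 := by lia
        have h6 : j + 1 ≠ -1 := by lia
        simp [fwdT₁, walk_single, h1, h2, h3, h5, h6, hj.ne]
  · simp [fwdT₁, walk_single, h.R₁_neg, h.L₁_neg_one, h.Rτ_zero]
  · have h1 : 1 ≤ j := by lia
    have h2 : 0 ≤ j + 1 := by lia
    have h3 : -1 - j < -1 := by lia
    have e1 : -1 - (j - 1) = -1 - j + 1 := by ring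
    have e2 : -1 - (j + 1) = -1 - j - 1 := by ring
    simp [fwdT₁, walk_single, h1, h2, hj.le, h.R₁_neg (-1 - j) (by lia), h.L₁_neg _ h3, e1, e2]
    abel

theorem comm_T₂ (h : BasisChange Rσ Lσ Rτ Lτ R₁ L₁ R₂ L₂ φ l r) (v : ℤ →₀ A) :
    fwdT₂ r (walk Rτ Lτ v) = walk R₂ L₂ (fwdT₂ r v) := by
  suffices H : fwdT₂ r ∘ₗ walk Rτ Lτ = walk R₂ L₂ ∘ₗ fwdT₂ r from LinearMap.congr_fun H v
  refine hom_ext_single fun j => ?_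
  rcases lt_trichotomy j 0 with hj | rfl | hj
  · have h1 : ¬ 1 ≤ j := by lia
    have h2 : ¬ 0 ≤ j := by lia
    by_cases h3 : j = -1
    · subst h3
      simp [fwdT₂, walk_single, h.Lτ_neg_one, h.R₂_zero, h.L₂_nonneg, mul_assoc, -Finsupp.single_mul]
    · have h5 : ¬ 0 ≤ j + 1 := by lia
      have h6 : j + 1 ≠ 0 := by lia
      have h7 : j - 1 ≠ 0 := by lia
      have e1 : -1 - (j - 1) = -1 - j + 1 := by ring
      have e2 : -1 - (j + 1) = -1 - j - 1 := by ring
      simp [fwdT₂, walk_single, h1, h2, h5, h6, h7, hj.ne, h.R₂_pos (-1 - j) (by lia),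
        h.L₂_nonneg (-1 - j) (by lia), e1, e2]
  · simp [fwdT₂, walk_single, h.R₂_neg, h.L₂_neg_one, h.Rτ_zero, h.r_mul]
  · have h1 : 1 ≤ j := by lia
    have h2 : 0 ≤ j + 1 := by lia
    have h3 : j + 1 ≠ 0 := by lia
    by_cases h4 : j = 1
    -- The summand `-r * y (-1)` of the image of `t 0` is killed by the map from `t 1`.
    · subst h4; simp [fwdT₂, walk_single, h.mul_r]
    · have h5 : j - 1 ≠ 0 := by lia
      simp [fwdT₂, walk_single, h1, h2, h3, h5, hj.le, hj.ne']

end BasisChange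

end

/-! ### The strings of the cone -/

section

variable {k V E : Type*} [Field k] [Fintype V] {Q : Quiv V E} {I : Ideal (PathAlgebra k Q)}
  {σ τ : GWord V E} {f fL fR : List E}

theorem not_mem_of_append_left [I.IsTwoSided] {p q : List E} (h : ofArrows k Q (p ++ q) ∉ I) :
    ofArrows k Q p ∉ I := by
  rw [ofArrows_append] at h
  exact fun hp => h (I.mul_mem_right _ hp)

theorem not_mem_of_append_right {p q : List E} (h : ofArrows k Q (p ++ q) ∉ I) :
    ofArrows k Q q ∉ I := by
  rw [ofArrows_append] at h
  exact fun hq => h (I.mul_mem_left _ hq)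

theorem IsHomotopyString.zero_mem_of_le {w : GWord V E} (h : IsHomotopyString Q I w)
    (h0 : 0 ∈ w.dom) : ∀ i ∈ w.dom, i < 0 → -1 ∈ w.dom :=
  fun i hi hi0 => h.interval.out hi h0 ⟨by lia, by lia⟩

variable (I) in
open Classical in
/-- The element of `Λ` given by a path `p`, or zero if `w` has no letter to the right of `vtx 0`. It is
used for the paths `f_R` and `f_L`, which are meaningful only if `σ_R`, respectively `τ_R`, is
nonempty. -/
def rightElt [I.IsTwoSided] (w : GWord V E) (p : List E) : PathAlgebra k Q ⧸ I :=
  if -1 ∈ w.dom then pathElt I p else 0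

namespace IsSingletonSingleMap

/-- The path `σ_R = f f_R` is nonzero, and `f_R` is a nontrivial path from `vtx (-1)` of `σ` to
`vtx 0` of `τ`. -/
theorem source_right (hf : IsSingletonSingleMap I σ τ f fL fR) (hσ : IsHomotopyString Q I σ)
    (h : -1 ∈ σ.dom) :
    ofArrows k Q (f ++ fR) ∉ I ∧ IsNontrivialPath Q I (τ.vtx 0) fR (σ.vtx (-1)) ∧
      σ.deg (-1) = σ.deg 0 + 1 := by
  have hl := hσ.letters (-1)
  rw [neg_add_cancel, hf.source_eq h] at hl
  replace hl := hl hf.mem_source h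
  obtain ⟨⟨-, hp, hn⟩, hd⟩ := hl
  obtain ⟨y, h1, h2⟩ := hp.exists_of_append
  obtain rfl := h1.src_unique hf.path.1 hf.path.2.1
  exact ⟨hn, ⟨hf.source_ne h, h2, not_mem_of_append_right hn⟩, hd⟩

variable [I.IsTwoSided]

/-- The path `f_L f` with `τ_R = (f_L f)⁻¹` is nonzero, and `f_L` is a nontrivial path from `vtx 0` of
`σ` to `vtx (-1)` of `τ`. -/
theorem target_right (hf : IsSingletonSingleMap I σ τ f fL fR) (hτ : IsHomotopyString Q I τ)
    (h : -1 ∈ τ.dom) :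
    ofArrows k Q (fL ++ f) ∉ I ∧ IsNontrivialPath Q I (τ.vtx (-1)) fL (σ.vtx 0) ∧
      τ.deg 0 = τ.deg (-1) + 1 := by
  have hl := hτ.letters (-1)
  rw [neg_add_cancel, hf.target_eq h] at hl
  replace hl := hl hf.mem_target h
  obtain ⟨⟨-, hp, hn⟩, hd⟩ := hl
  obtain ⟨y, h1, h2⟩ := hp.exists_of_append
  obtain rfl := h2.tgt_unique hf.path.1 hf.path.2.1
  exact ⟨hn, ⟨hf.target_ne h, h1, not_mem_of_append_left hn⟩, hd⟩

/-- If `σ_L = p⁻¹` is inverse, then `f` and `p` start with different (leftmost) arrows, since neither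
contains the other as an initial segment. -/
theorem left_head_ne (hf : IsSingletonSingleMap I σ τ f fL fR) (hI : IsGentle Q I)
    (hσ : IsHomotopyString Q I σ) (h : 1 ∈ σ.dom) {p : List E} (hp : σ.letter 0 = .inv p) :
    ∀ a ∈ f.head?, ∀ b ∈ p.head?, a ≠ b := by
  have hl := hσ.letters 0 h hf.mem_source
  rw [hp] at hl
  exact hI.head_ne hf.path.2.2 hl.1.2.2 (hf.not_sub_left h p hp) (hf.not_sub_left' h p hp)

/-- If `τ_L = p` is direct, then `f` and `p` end with different (rightmost) arrows, since neither
contains the other as a final segment. -/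
theorem left_getLast_ne (hf : IsSingletonSingleMap I σ τ f fL fR) (hI : IsGentle Q I)
    (hτ : IsHomotopyString Q I τ) (h : 1 ∈ τ.dom) {p : List E} (hp : τ.letter 0 = .dir p) :
    ∀ a ∈ f.getLast?, ∀ b ∈ p.getLast?, a ≠ b := by
  have hl := hτ.letters 0 h hf.mem_target
  rw [hp] at hl
  exact hI.getLast_ne hf.path.2.2 hl.1.2.2 (hf.not_sub_right h p hp) (hf.not_sub_right' h p hp)

/-- The two junctions at `f` hold by compatible orientation: zero relations if the neighbouring letter
points in the direction of `f`, different arrows otherwise. -/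
theorem isHomotopyString_coneString₁ (hf : IsSingletonSingleMap I σ τ f fL fR) (hI : IsGentle Q I)
    (hσ : IsHomotopyString Q I σ) (hτ : IsHomotopyString Q I τ) :
    IsHomotopyString Q I (coneString₁ σ τ f) := by
  refine hσ.shift.glue hτ.bar (fun _ _ _ => hf.mem_source)
    (fun _ _ _ => hf.mem_target) (fun _ _ => ⟨hf.path, ?_⟩) (fun h1 _ _ => ?_) (fun _ _ h1 => ?_)
  · change τ.deg 0 = σ.deg 0 - 1 + 1
    rw [hf.deg_eq]; ring
  · have h1 : 1 ∈ σ.dom := h1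
    have hl := hσ.letters 0 h1 hf.mem_source
    change Junction Q I (σ.letter 0) (.dir f)
    cases hp : σ.letter 0 with
    | dir p =>
      rw [hp] at hl
      exact hI.mem_of_append_mem hl.1 hf.path (hf.zero_left h1 p hp)
    | inv p => exact fun a ha b hb => (hf.left_head_ne hI hσ h1 hp b hb a ha).symm
  · have h1 : 1 ∈ τ.dom := h1
    have hl := hτ.letters 0 h1 hf.mem_target
    change Junction Q I (.dir f) (τ.letter 0).bar
    cases hp : τ.letter 0 with
    | dir p => exact hf.left_getLast_ne hI hτ h1 hp
    | inv p =>
      rw [hp] at hl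
      exact hI.mem_of_append_mem hf.path hl.1 (hf.zero_right h1 p hp)

/-- The letter `f_L f f_R` is a nonzero path by `IsGentle.overlap`, and its junctions are those of
`f f_R` in `σ` and of `f_L f` in `τ`, since `f_R` and `f_L` are at its ends. -/
theorem isHomotopyString_coneString₂ (hf : IsSingletonSingleMap I σ τ f fL fR) (hI : IsGentle Q I)
    (hσ : IsHomotopyString Q I σ) (hτ : IsHomotopyString Q I τ) :
    IsHomotopyString Q I (coneString₂ σ τ f fL fR) := by
  refine hτ.bar.glue hσ.shift
    (fun i hi hi0 => hτ.zero_mem_of_le hf.mem_target (-1 - i) hi (by lia))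
    (hσ.zero_mem_of_le hf.mem_source) (fun h0 h1 => ?_) (fun h1 h0 hn => ?_) (fun h0 h1 h2 => ?_)
  · obtain ⟨hn, hR, hd⟩ := hf.source_right hσ h1
    obtain ⟨hn', hL, hd'⟩ := hf.target_right hτ h0
    refine ⟨⟨by simp [hf.path.1], (hL.2.1.append hf.path.2.1).append hR.2.1,
      hI.overlap hf.path.1 hL.2.1 hf.path.2.1 hR.2.1 hn' hn⟩, ?_⟩
    change σ.deg (-1) - 1 = τ.deg (-1) + 1
    rw [hd, ← hd', hf.deg_eq]; ring
  · have h0 : -1 ∈ τ.dom := h0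
    have hj := hτ.junctions (-2)
    rw [show (-2 : ℤ) + 1 = -1 by norm_num, neg_add_cancel, hf.target_eq h0] at hj
    replace hj := (hj hf.mem_target h0 h1).bar
    change Junction Q I (τ.letter (-2)).bar _
    have e : (fL ++ f ++ fR).head? = (fL ++ f).head? :=
      List.head?_append_of_ne_nil _ (by simp [hf.path.1])
    cases hp : τ.letter (-2) <;> rw [hp] at hj <;>
      simpa only [Junction, Letter.bar, e] using hj
  · have h1 : -1 ∈ σ.dom := h1
    have hj := hσ.junctions (-2)
    rw [show (-2 : ℤ) + 1 = -1 by norm_num, neg_add_cancel, hf.source_eq h1] at hj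
    replace hj := hj hf.mem_source h1 h2
    change Junction Q I _ (σ.letter (-2))
    have e : (fL ++ f ++ fR).getLast? = (f ++ fR).getLast? := by
      rw [List.append_assoc, List.getLast?_append_of_ne_nil _ (by simp [hf.path.1])]
    cases hp : σ.letter (-2) <;> rw [hp] at hj <;> simpa only [Junction, e] using hj

/-- The string complexes satisfy the relations `BasisChange`. The products `f_L σ_L⁻¹` and `τ_L f_R`
vanish because `f_L f` and `f f_R` are nonzero and the letters next to `f` branch off from it; the
other two zero relations are junction conditions of `τ` and `σ`. -/
theorem basisChange (hf : IsSingletonSingleMap I σ τ f fL fR) (hI : IsGentle Q I)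
    (hσ : IsHomotopyString Q I σ) (hτ : IsHomotopyString Q I τ) :
    BasisChange (toRight I σ) (toLeft I σ) (toRight I τ) (toLeft I τ)
      (toRight I (coneString₁ σ τ f)) (toLeft I (coneString₁ σ τ f))
      (toRight I (coneString₂ σ τ f fL fR)) (toLeft I (coneString₂ σ τ f fL fR))
      (pathElt I f) (rightElt I τ fL) (rightElt I σ fR) where
  R₁_pos i hi := toRight_glue_of_pos I _ _ _ hi
  R₁_zero := by
    rw [coneString₁, toRight_glue_zero]
    exact if_pos ⟨hf.mem_source, hf.mem_target⟩
  R₁_neg i hi := by rw [coneString₁, toRight_glue_of_neg I _ _ _ hi, toRight_bar]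
  L₁_nonneg i hi := toLeft_glue_of_nonneg I _ _ _ hi
  L₁_neg_one := toLeft_glue_neg_one I _ _ _
  L₁_neg i hi := by rw [coneString₁, toLeft_glue_of_neg I _ _ _ hi, toLeft_bar]
  R₂_pos i hi := by rw [coneString₂, toRight_glue_of_pos I _ _ _ hi, toRight_bar]
  R₂_zero := by
    rw [coneString₂, toRight_glue_zero, rightElt, rightElt]
    have e1 : (0 ∈ τ.bar.dom) = (-1 ∈ τ.dom) := rfl
    have e2 : (-1 ∈ σ.shift.dom) = (-1 ∈ σ.dom) := rfl
    by_cases h1 : -1 ∈ τ.dom <;> by_cases h2 : -1 ∈ σ.dom <;>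
      simp [e1, e2, h1, h2, pathElt_append, mul_assoc]
  R₂_neg i hi := toRight_glue_of_neg I _ _ _ hi
  L₂_nonneg i hi := by rw [coneString₂, toLeft_glue_of_nonneg I _ _ _ hi, toLeft_bar]
  L₂_neg_one := toLeft_glue_neg_one I _ _ _
  L₂_neg i hi := toLeft_glue_of_neg I _ _ _ hi
  Rσ_zero := by
    rw [toRight, rightElt, zero_sub]
    by_cases h : -1 ∈ σ.dom
    · simp [h, hf.mem_source, hf.source_eq h, pathElt_append]
    · simp [h]
  Lσ_neg_one := by
    rw [toLeft]
    by_cases h : -1 ∈ σ.dom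
    · simp [hf.source_eq h]
    · simp [h]
  Rτ_zero := by
    rw [toRight, zero_sub]
    by_cases h : -1 ∈ τ.dom
    · simp [hf.target_eq h]
    · simp [h]
  Lτ_neg_one := by
    rw [toLeft, rightElt, neg_add_cancel]
    by_cases h : -1 ∈ τ.dom
    · simp [h, hf.mem_target, hf.target_eq h, pathElt_append]
    · simp [h]
  l_mul := by
    rw [rightElt]
    split_ifs with h
    · rcases toLeft_cases I hσ 0 with h0 | ⟨p, -, h1, hp, he, hn, -⟩
      · rw [h0, mul_zero]
      · rw [he]
        exact hI.pathElt_mul_eq_zero_of_head_ne (hf.target_ne h) hf.path.1 hn.1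
          (hf.target_right hτ h).1 (hf.left_head_ne hI hσ (by simpa using h1) hp)
    · rw [zero_mul]
  mul_r := by
    rw [rightElt]
    split_ifs with h
    · rcases toRight_cases I hτ 1 with h0 | ⟨p, h1, -, hp, he, hn, -⟩
      · rw [h0, zero_mul]
      · rw [he]
        rw [sub_self] at hp
        exact hI.pathElt_mul_eq_zero_of_getLast_ne (hf.source_ne h) hf.path.1 hn.1
          (hf.source_right hσ h).1 (hf.left_getLast_ne hI hτ h1 hp)
    · rw [mul_zero]
  mul_l := by
    rw [rightElt]
    split_ifs with h
    · rcases toLeft_cases I hτ (-2) with h0 | ⟨p, h2, -, hp, he, hn, -⟩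
      · rw [h0, zero_mul]
      · have hj := hτ.junctions (-2)
        rw [show (-2 : ℤ) + 1 = -1 by norm_num, neg_add_cancel, hf.target_eq h, hp] at hj
        rw [he]
        refine pathElt_mul_eq_zero I hn.1 (hf.target_ne h) fun a ha b hb => ?_
        exact hj hf.mem_target h h2 a ha b (by simp [List.head?_append, Option.mem_def.1 hb])
    · rw [mul_zero]
  r_mul := by
    rw [rightElt]
    split_ifs with h
    · rcases toRight_cases I hσ (-1) with h0 | ⟨p, -, h2, hp, he, hn, -⟩
      · rw [h0, mul_zero]
      · have hj := hσ.junctions (-2)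
        rw [show (-1 : ℤ) - 1 = -2 by norm_num] at hp h2
        rw [show (-2 : ℤ) + 1 = -1 by norm_num, neg_add_cancel, hf.source_eq h, hp] at hj
        rw [he]
        refine pathElt_mul_eq_zero I (hf.source_ne h) hn.1 fun a ha b hb => ?_
        exact hj hf.mem_source h h2 a (by simp [List.getLast?_append, Option.mem_def.1 ha]) b hb
    · rw [zero_mul]

end IsSingletonSingleMap

end

/-! ### Isomorphisms from a mapping cone -/

section

open CochainComplex CochainComplex.HomComplex

variable {C : Type*} [Category* C] [Preadditive C] {F G : CochainComplex C ℤ} (φ : F ⟶ G)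
  [HomologicalComplex.HasHomotopyCofiber φ]

/-- A complex `K` is isomorphic to the mapping cone of `φ : F ⟶ G` if its terms are biproducts of the
terms of `F[1]` and `G` (with inclusions `α`, `β` and projections `α'`, `β'`) and if in terms of the
inclusions its differential is that of the mapping cone. -/
theorem nonempty_mappingCone_iso {K : CochainComplex C ℤ}
    (α : ∀ n, F.X (n + 1) ⟶ K.X n) (β : ∀ n, G.X n ⟶ K.X n)
    (α' : ∀ n, K.X n ⟶ F.X (n + 1)) (β' : ∀ n, K.X n ⟶ G.X n)
    (hα : ∀ n, α n ≫ K.d n (n + 1) =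
      φ.f (n + 1) ≫ β (n + 1) - F.d (n + 1) (n + 1 + 1) ≫ α (n + 1))
    (hβ : ∀ n, β n ≫ K.d n (n + 1) = G.d n (n + 1) ≫ β (n + 1))
    (h₁ : ∀ n, α n ≫ α' n = 𝟙 _) (h₂ : ∀ n, α n ≫ β' n = 0) (h₃ : ∀ n, β n ≫ α' n = 0)
    (h₄ : ∀ n, β n ≫ β' n = 𝟙 _) (h₅ : ∀ n, α' n ≫ α n + β' n ≫ β n = 𝟙 _) :
    Nonempty (mappingCone φ ≅ K) := by
  refine ⟨HomologicalComplex.Hom.isoOfComponents (fun n => ⟨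
    (mappingCone.fst φ).1.v n (n + 1) rfl ≫ α n +
      (mappingCone.snd φ).v n n (add_zero n) ≫ β n,
    α' n ≫ (mappingCone.inl φ).v (n + 1) n (by lia) + β' n ≫ (mappingCone.inr φ).f n,
    ?_, ?_⟩) ?_⟩
  · rw [mappingCone.ext_from_iff φ (n + 1) n rfl]
    constructor
    · simp [reassoc_of% (h₁ n), reassoc_of% (h₂ n)]
    · simp [reassoc_of% (h₃ n), reassoc_of% (h₄ n)]
  · simp [h₅]
  · rintro n _ rfl
    rw [mappingCone.ext_from_iff φ (n + 1) n rfl]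
    constructor
    · simp [hα, mappingCone.inl_v_d_assoc φ (n + 1) n (n + 1 + 1) (by lia) (by lia)]
      abel
    · simp [hβ]

/-- The version of `nonempty_mappingCone_iso` for a direct sum of two complexes, in terms of the
entries of the matrices of the isomorphism and of its inverse. -/
theorem nonempty_mappingCone_iso_biprod {K L : CochainComplex C ℤ} [HasBinaryBiproducts C]
    (a₁ : ∀ n, F.X (n + 1) ⟶ K.X n) (a₂ : ∀ n, F.X (n + 1) ⟶ L.X n)
    (b₁ : ∀ n, G.X n ⟶ K.X n) (b₂ : ∀ n, G.X n ⟶ L.X n)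
    (a₁' : ∀ n, K.X n ⟶ F.X (n + 1)) (a₂' : ∀ n, L.X n ⟶ F.X (n + 1))
    (b₁' : ∀ n, K.X n ⟶ G.X n) (b₂' : ∀ n, L.X n ⟶ G.X n)
    (ha₁ : ∀ n, a₁ n ≫ K.d n (n + 1) =
      φ.f (n + 1) ≫ b₁ (n + 1) - F.d (n + 1) (n + 1 + 1) ≫ a₁ (n + 1))
    (ha₂ : ∀ n, a₂ n ≫ L.d n (n + 1) =
      φ.f (n + 1) ≫ b₂ (n + 1) - F.d (n + 1) (n + 1 + 1) ≫ a₂ (n + 1))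
    (hb₁ : ∀ n, b₁ n ≫ K.d n (n + 1) = G.d n (n + 1) ≫ b₁ (n + 1))
    (hb₂ : ∀ n, b₂ n ≫ L.d n (n + 1) = G.d n (n + 1) ≫ b₂ (n + 1))
    (e₁ : ∀ n, a₁ n ≫ a₁' n + a₂ n ≫ a₂' n = 𝟙 _)
    (e₂ : ∀ n, a₁ n ≫ b₁' n + a₂ n ≫ b₂' n = 0)
    (e₃ : ∀ n, b₁ n ≫ a₁' n + b₂ n ≫ a₂' n = 0)
    (e₄ : ∀ n, b₁ n ≫ b₁' n + b₂ n ≫ b₂' n = 𝟙 _)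
    (e₅ : ∀ n, a₁' n ≫ a₁ n + b₁' n ≫ b₁ n = 𝟙 _)
    (e₆ : ∀ n, a₁' n ≫ a₂ n + b₁' n ≫ b₂ n = 0)
    (e₇ : ∀ n, a₂' n ≫ a₁ n + b₂' n ≫ b₁ n = 0)
    (e₈ : ∀ n, a₂' n ≫ a₂ n + b₂' n ≫ b₂ n = 𝟙 _) :
    Nonempty (mappingCone φ ≅ K ⊞ L) := by
  have i₁ (n : ℤ) : (biprod.inl : K ⟶ K ⊞ L).f n ≫ (biprod.fst : K ⊞ L ⟶ K).f n = 𝟙 _ := by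
    rw [← HomologicalComplex.comp_f, biprod.inl_fst, HomologicalComplex.id_f]
  have i₂ (n : ℤ) : (biprod.inl : K ⟶ K ⊞ L).f n ≫ (biprod.snd : K ⊞ L ⟶ L).f n = 0 := by
    rw [← HomologicalComplex.comp_f, biprod.inl_snd, HomologicalComplex.zero_f]
  have i₃ (n : ℤ) : (biprod.inr : L ⟶ K ⊞ L).f n ≫ (biprod.fst : K ⊞ L ⟶ K).f n = 0 := by
    rw [← HomologicalComplex.comp_f, biprod.inr_fst, HomologicalComplex.zero_f]
  have i₄ (n : ℤ) : (biprod.inr : L ⟶ K ⊞ L).f n ≫ (biprod.snd : K ⊞ L ⟶ L).f n = 𝟙 _ := by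
    rw [← HomologicalComplex.comp_f, biprod.inr_snd, HomologicalComplex.id_f]
  have i₅ (n : ℤ) : (biprod.fst : K ⊞ L ⟶ K).f n ≫ (biprod.inl : K ⟶ K ⊞ L).f n +
      (biprod.snd : K ⊞ L ⟶ L).f n ≫ (biprod.inr : L ⟶ K ⊞ L).f n = 𝟙 _ := by
    rw [← HomologicalComplex.comp_f, ← HomologicalComplex.comp_f, ← HomologicalComplex.add_f_apply,
      biprod.total, HomologicalComplex.id_f]
  refine nonempty_mappingCone_iso φ
    (fun n => a₁ n ≫ (biprod.inl : K ⟶ K ⊞ L).f n + a₂ n ≫ (biprod.inr : L ⟶ K ⊞ L).f n)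
    (fun n => b₁ n ≫ (biprod.inl : K ⟶ K ⊞ L).f n + b₂ n ≫ (biprod.inr : L ⟶ K ⊞ L).f n)
    (fun n => (biprod.fst : K ⊞ L ⟶ K).f n ≫ a₁' n + (biprod.snd : K ⊞ L ⟶ L).f n ≫ a₂' n)
    (fun n => (biprod.fst : K ⊞ L ⟶ K).f n ≫ b₁' n + (biprod.snd : K ⊞ L ⟶ L).f n ≫ b₂' n)
    (fun n => ?_) (fun n => ?_) (fun n => ?_) (fun n => ?_) (fun n => ?_) (fun n => ?_)
    (fun n => ?_)
  · simp only [Preadditive.add_comp, Preadditive.comp_add, Category.assoc,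
      HomologicalComplex.Hom.comm, reassoc_of% (ha₁ n), reassoc_of% (ha₂ n), Preadditive.sub_comp]
    abel
  · simp only [Preadditive.add_comp, Preadditive.comp_add, Category.assoc,
      HomologicalComplex.Hom.comm, reassoc_of% (hb₁ n), reassoc_of% (hb₂ n)]
  · simp [reassoc_of% (i₁ n), reassoc_of% (i₂ n), reassoc_of% (i₃ n), reassoc_of% (i₄ n), e₁]
  · simp [reassoc_of% (i₁ n), reassoc_of% (i₂ n), reassoc_of% (i₃ n), reassoc_of% (i₄ n), e₂]
  · simp [reassoc_of% (i₁ n), reassoc_of% (i₂ n), reassoc_of% (i₃ n), reassoc_of% (i₄ n), e₃]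
  · simp [reassoc_of% (i₁ n), reassoc_of% (i₂ n), reassoc_of% (i₃ n), reassoc_of% (i₄ n), e₄]
  · calc
      _ = (biprod.fst : K ⊞ L ⟶ K).f n ≫ (a₁' n ≫ a₁ n + b₁' n ≫ b₁ n) ≫ (biprod.inl : K ⟶ K ⊞ L).f n +
          (biprod.fst : K ⊞ L ⟶ K).f n ≫ (a₁' n ≫ a₂ n + b₁' n ≫ b₂ n) ≫ (biprod.inr : L ⟶ K ⊞ L).f n +
          ((biprod.snd : K ⊞ L ⟶ L).f n ≫ (a₂' n ≫ a₁ n + b₂' n ≫ b₁ n) ≫ (biprod.inl : K ⟶ K ⊞ L).f n +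
          (biprod.snd : K ⊞ L ⟶ L).f n ≫ (a₂' n ≫ a₂ n + b₂' n ≫ b₂ n) ≫ (biprod.inr : L ⟶ K ⊞ L).f n) := by
        simp only [Preadditive.add_comp, Preadditive.comp_add, Category.assoc]
        abel
      _ = 𝟙 _ := by
        rw [e₅, e₆, e₇, e₈, Category.id_comp, Category.id_comp, zero_comp, zero_comp, comp_zero,
          comp_zero, add_zero, zero_add, i₅]

end

section

variable {k V E : Type*} [Field k] [Fintype V] {Q : Quiv V E} (I : Ideal (PathAlgebra k Q))
  [I.IsTwoSided] {σ τ : GWord V E} {f fL fR : List E}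

theorem smul_single_mem_term {w : GWord V E} {n i : ℤ} {u c : PathAlgebra k Q ⧸ I}
    (h : u * c ∈ proj I (w.vtx i)) (hi : i ∈ w.dom) (hn : w.deg i = n) :
    u • Finsupp.single i c ∈ term I w n := by
  rw [Finsupp.smul_single]
  exact single_mem_term I h fun _ => ⟨hi, hn⟩

/-- A linear map given by the images of the basis elements restricts to terms of string complexes if
it does so on the projectives that make them up. -/
theorem comb_mem_term {w w' : GWord V E} {n m : ℤ} (g : ℤ → ℤ →₀ PathAlgebra k Q ⧸ I)
    (h : ∀ i ∈ w.dom, w.deg i = n → ∀ u ∈ proj I (w.vtx i), u • g i ∈ term I w' m)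
    {v : ℤ →₀ PathAlgebra k Q ⧸ I} (hv : v ∈ term I w n) : comb g v ∈ term I w' m := by
  rw [comb, Finsupp.linearCombination_apply]
  refine sum_mem fun i hi => ?_
  obtain ⟨h1, h2⟩ := (hv i).2 (Finsupp.mem_support_iff.1 hi)
  exact h i h1 h2 _ (hv i).1

theorem mul_sgn_mem {x : V} {u : PathAlgebra k Q ⧸ I} (hu : u ∈ proj I x) (i : ℤ) :
    u * sgn _ i ∈ proj I x := by
  rw [← sgn_comm]
  exact Submodule.smul_mem _ _ hu

theorem smul_single_rightElt_mem_term {w w' : GWord V E} {p : List E} {m j : ℤ}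
    (h : -1 ∈ w.dom → (∃ y, IsNontrivialPath Q I y p (w'.vtx j)) ∧ j ∈ w'.dom ∧ w'.deg j = m)
    (u : PathAlgebra k Q ⧸ I) : u • Finsupp.single j (rightElt I w p) ∈ term I w' m := by
  rw [rightElt]
  split_ifs with h0
  · obtain ⟨⟨y, hy⟩, hj, hm⟩ := h h0
    exact smul_single_mem_term I (mul_pathElt_mem I hy u) hj hm
  · rw [Finsupp.single_zero, smul_zero]; exact zero_mem _

variable {I}

/-! ### The change of basis on the terms of the complexes -/

theorem fwdS₁_mem {n m : ℤ} (hnm : n = m + 1) {v : ℤ →₀ PathAlgebra k Q ⧸ I}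
    (hv : v ∈ term I σ n) : fwdS₁ v ∈ term I (coneString₁ σ τ f) m := by
  refine comb_mem_term I _ (fun i hi hn u hu => ?_) hv
  split_ifs with h
  · refine smul_single_mem_term I ?_ ?_ ?_
    · rw [coneString₁, GWord.glue_vtx_of_nonneg _ _ _ h]
      exact mul_sgn_mem I hu i
    · exact (GWord.mem_glue_of_nonneg _ _ _ h).2 hi
    · rw [coneString₁, GWord.glue_deg_of_nonneg _ _ _ h]
      change σ.deg i - 1 = m
      lia
  · rw [smul_zero]; exact zero_mem _

theorem fwdS₂_mem {n m : ℤ} (hnm : n = m + 1) {v : ℤ →₀ PathAlgebra k Q ⧸ I}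
    (hv : v ∈ term I σ n) : fwdS₂ v ∈ term I (coneString₂ σ τ f fL fR) m := by
  refine comb_mem_term I _ (fun i hi hn u hu => ?_) hv
  split_ifs with h
  · rw [smul_zero]; exact zero_mem _
  · have h := lt_of_not_ge h
    refine smul_single_mem_term I ?_ ?_ ?_
    · rw [coneString₂, GWord.glue_vtx_of_neg _ _ _ h]
      exact mul_sgn_mem I hu i
    · exact (GWord.mem_glue_of_neg _ _ _ h).2 hi
    · rw [coneString₂, GWord.glue_deg_of_neg _ _ _ h]
      change σ.deg i - 1 = m
      lia

theorem bwdT₁_mem {n : ℤ} {v : ℤ →₀ PathAlgebra k Q ⧸ I}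
    (hv : v ∈ term I (coneString₁ σ τ f) n) : bwdT₁ v ∈ term I τ n := by
  refine comb_mem_term I _ (fun i hi hn u hu => ?_) hv
  split_ifs with h
  · rw [smul_zero]; exact zero_mem _
  · have h := lt_of_not_ge h
    rw [coneString₁, GWord.glue_vtx_of_neg _ _ _ h] at hu
    rw [coneString₁, GWord.glue_deg_of_neg _ _ _ h] at hn
    refine smul_single_mem_term I ?_ ((GWord.mem_glue_of_neg _ _ _ h).1 hi) hn
    rw [mul_one]
    exact hu

theorem bwdT₂_mem {n : ℤ} {v : ℤ →₀ PathAlgebra k Q ⧸ I}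
    (hv : v ∈ term I (coneString₂ σ τ f fL fR) n) : bwdT₂ v ∈ term I τ n := by
  refine comb_mem_term I _ (fun i hi hn u hu => ?_) hv
  split_ifs with h
  · rw [coneString₂, GWord.glue_vtx_of_nonneg _ _ _ h] at hu
    rw [coneString₂, GWord.glue_deg_of_nonneg _ _ _ h] at hn
    refine smul_single_mem_term I ?_ ((GWord.mem_glue_of_nonneg _ _ _ h).1 hi) hn
    rw [mul_neg_one]
    exact neg_mem hu
  · rw [smul_zero]; exact zero_mem _

namespace IsSingletonSingleMap

theorem fwdT₁_mem (hf : IsSingletonSingleMap I σ τ f fL fR) (hτ : IsHomotopyString Q I τ) {n : ℤ}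
    {v : ℤ →₀ PathAlgebra k Q ⧸ I} (hv : v ∈ term I τ n) :
    fwdT₁ (rightElt I τ fL) v ∈ term I (coneString₁ σ τ f) n := by
  refine comb_mem_term I _ (fun j hj hn u hu => ?_) hv
  have hb : -1 - (-1 - j) = j := by ring
  split_ifs with h h'
  · have h0 : -1 - j < 0 := by lia
    refine smul_single_mem_term I ?_ ?_ ?_
    · rw [coneString₁, GWord.glue_vtx_of_neg _ _ _ h0, mul_one]
      change u ∈ proj I (τ.vtx (-1 - (-1 - j)))
      rwa [hb]
    · refine (GWord.mem_glue_of_neg _ _ _ h0).2 (?_ : -1 - (-1 - j) ∈ τ.dom)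
      rwa [hb]
    · rw [coneString₁, GWord.glue_deg_of_neg _ _ _ h0]
      change τ.deg (-1 - (-1 - j)) = n
      rwa [hb]
  · subst h'
    refine smul_single_rightElt_mem_term I (fun h => ?_) u
    obtain ⟨-, h1, h2⟩ := hf.target_right hτ h
    refine ⟨⟨_, h1⟩, hf.mem_source, ?_⟩
    change σ.deg 0 - 1 = n
    have := hf.deg_eq
    lia
  · rw [smul_zero]; exact zero_mem _

theorem fwdT₂_mem (hf : IsSingletonSingleMap I σ τ f fL fR) (hσ : IsHomotopyString Q I σ) {n : ℤ}
    {v : ℤ →₀ PathAlgebra k Q ⧸ I} (hv : v ∈ term I τ n) :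
    fwdT₂ (rightElt I σ fR) v ∈ term I (coneString₂ σ τ f fL fR) n := by
  refine comb_mem_term I _ (fun j hj hn u hu => ?_) hv
  have hb : -1 - (-1 - j) = j := by ring
  split_ifs with h h'
  · subst h
    rw [Finsupp.single_neg, smul_neg]
    refine neg_mem (smul_single_rightElt_mem_term I (fun h => ?_) u)
    obtain ⟨-, h1, h2⟩ := hf.source_right hσ h
    refine ⟨⟨_, h1⟩, h, ?_⟩
    change σ.deg (-1) - 1 = n
    have := hf.deg_eq
    lia
  · rw [smul_zero]; exact zero_mem _
  · have h0 : 0 ≤ -1 - j := by lia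
    refine smul_single_mem_term I ?_ ?_ ?_
    · rw [coneString₂, GWord.glue_vtx_of_nonneg _ _ _ h0, mul_neg_one]
      change -u ∈ proj I (τ.vtx (-1 - (-1 - j)))
      rw [hb]
      exact neg_mem hu
    · refine (GWord.mem_glue_of_nonneg _ _ _ h0).2 (?_ : -1 - (-1 - j) ∈ τ.dom)
      rwa [hb]
    · rw [coneString₂, GWord.glue_deg_of_nonneg _ _ _ h0]
      change τ.deg (-1 - (-1 - j)) = n
      rwa [hb]

theorem bwdS₁_mem (hf : IsSingletonSingleMap I σ τ f fL fR) (hσ : IsHomotopyString Q I σ)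
    {n m : ℤ} (hnm : m = n + 1) {v : ℤ →₀ PathAlgebra k Q ⧸ I}
    (hv : v ∈ term I (coneString₁ σ τ f) n) : bwdS₁ (rightElt I σ fR) v ∈ term I σ m := by
  refine comb_mem_term I _ (fun i hi hn u hu => ?_) hv
  split_ifs with h h'
  · rw [coneString₁, GWord.glue_vtx_of_nonneg _ _ _ h] at hu
    rw [coneString₁, GWord.glue_deg_of_nonneg _ _ _ h] at hn
    refine smul_single_mem_term I (mul_sgn_mem I hu i)
      ((GWord.mem_glue_of_nonneg σ.shift _ _ h).1 hi) ?_
    have hn : σ.deg i - 1 = n := hn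
    lia
  · subst h'
    rw [Finsupp.single_neg, smul_neg]
    refine neg_mem (smul_single_rightElt_mem_term I (fun h => ?_) u)
    obtain ⟨-, h1, h2⟩ := hf.source_right hσ h
    refine ⟨⟨_, h1⟩, h, ?_⟩
    have hn : τ.deg 0 = n := hn
    have := hf.deg_eq
    lia
  · rw [smul_zero]; exact zero_mem _

theorem bwdS₂_mem (hf : IsSingletonSingleMap I σ τ f fL fR) (hτ : IsHomotopyString Q I τ)
    {n m : ℤ} (hnm : m = n + 1) {v : ℤ →₀ PathAlgebra k Q ⧸ I}
    (hv : v ∈ term I (coneString₂ σ τ f fL fR) n) : bwdS₂ (rightElt I τ fL) v ∈ term I σ m := by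
  refine comb_mem_term I _ (fun i hi hn u hu => ?_) hv
  split_ifs with h h'
  · subst h
    refine smul_single_rightElt_mem_term I (fun h => ?_) u
    obtain ⟨-, h1, h2⟩ := hf.target_right hτ h
    refine ⟨⟨_, h1⟩, hf.mem_source, ?_⟩
    have hn : τ.deg (-1) = n := hn
    have := hf.deg_eq
    lia
  · rw [smul_zero]; exact zero_mem _
  · have h' := lt_of_not_ge h'
    rw [coneString₂, GWord.glue_vtx_of_neg _ _ _ h'] at hu
    rw [coneString₂, GWord.glue_deg_of_neg _ _ _ h'] at hn
    refine smul_single_mem_term I (mul_sgn_mem I hu i)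
      ((GWord.mem_glue_of_neg _ σ.shift _ h').1 hi) ?_
    have hn : σ.deg i - 1 = n := hn
    lia

end IsSingletonSingleMap

end

section

variable {k V E : Type*} [Field k] [Fintype V] {Q : Quiv V E} {I : Ideal (PathAlgebra k Q)}
  [I.IsTwoSided] {σ τ : GWord V E} {f fL fR : List E}

/-! ### The isomorphism of complexes -/

/-- The morphism between terms of complexes of `Λ`-modules given by a linear map of the ambient
modules. -/
abbrev termHom {w w' : GWord V E} {n m : ℤ}
    (φ : (ℤ →₀ PathAlgebra k Q ⧸ I) →ₗ[PathAlgebra k Q ⧸ I] (ℤ →₀ PathAlgebra k Q ⧸ I))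
    (h : ∀ v ∈ term I w n, φ v ∈ term I w' m) :
    ModuleCat.of (PathAlgebra k Q ⧸ I) (term I w n) ⟶
      ModuleCat.of (PathAlgebra k Q ⧸ I) (term I w' m) :=
  ModuleCat.ofHom (φ.restrict h)

theorem termHom_ext {w w' : GWord V E} {n m : ℤ}
    {φ ψ : ModuleCat.of (PathAlgebra k Q ⧸ I) (term I w n) ⟶
      ModuleCat.of (PathAlgebra k Q ⧸ I) (term I w' m)}
    (h : ∀ v : term I w n, (φ.hom v).1 = (ψ.hom v).1) : φ = ψ :=
  ModuleCat.hom_ext (LinearMap.ext fun v => Subtype.ext (h v))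

theorem stringComplex_d {w : GWord V E} (hw : IsHomotopyString Q I w) (n : ℤ) :
    (stringComplex I w hw).d n (n + 1) = termHom (diff I w) (diff_mem I hw rfl) :=
  dif_pos rfl

/-- The isomorphism given by the change of basis. -/
theorem IsSingletonSingleMap.nonempty_iso (hf : IsSingletonSingleMap I σ τ f fL fR)
    (hI : IsGentle Q I) (hσ : IsHomotopyString Q I σ) (hτ : IsHomotopyString Q I τ)
    (h₁ : IsHomotopyString Q I (coneString₁ σ τ f))
    (h₂ : IsHomotopyString Q I (coneString₂ σ τ f fL fR)) :
    Nonempty (CochainComplex.mappingCone (singleMap I hσ hτ hf.toIsSingleMap) ≅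
      stringComplex I (coneString₁ σ τ f) h₁ ⊞ stringComplex I (coneString₂ σ τ f fL fR) h₂) := by
  have H := hf.basisChange hI hσ hτ
  let K := stringComplex I (coneString₁ σ τ f) h₁
  let L := stringComplex I (coneString₂ σ τ f fL fR) h₂
  let F := stringComplex I σ hσ
  let G := stringComplex I τ hτ
  let l := rightElt I τ fL
  let r := rightElt I σ fR
  let a₁ (n : ℤ) : F.X (n + 1) ⟶ K.X n := termHom fwdS₁ fun _ => fwdS₁_mem rfl
  let a₂ (n : ℤ) : F.X (n + 1) ⟶ L.X n := termHom fwdS₂ fun _ => fwdS₂_mem rfl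
  let b₁ (n : ℤ) : G.X n ⟶ K.X n := termHom (fwdT₁ l) fun _ => hf.fwdT₁_mem hτ
  let b₂ (n : ℤ) : G.X n ⟶ L.X n := termHom (fwdT₂ r) fun _ => hf.fwdT₂_mem hσ
  let a₁' (n : ℤ) : K.X n ⟶ F.X (n + 1) := termHom (bwdS₁ r) fun _ => hf.bwdS₁_mem hσ rfl
  let a₂' (n : ℤ) : L.X n ⟶ F.X (n + 1) := termHom (bwdS₂ l) fun _ => hf.bwdS₂_mem hτ rfl
  let b₁' (n : ℤ) : K.X n ⟶ G.X n := termHom bwdT₁ fun _ => bwdT₁_mem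
  let b₂' (n : ℤ) : L.X n ⟶ G.X n := termHom bwdT₂ fun _ => bwdT₂_mem
  let φ := singleMap I hσ hτ hf.toIsSingleMap
  have hdF (n : ℤ) : F.d n (n + 1) = termHom (diff I σ) (diff_mem I hσ rfl) := stringComplex_d hσ n
  have hdG (n : ℤ) : G.d n (n + 1) = termHom (diff I τ) (diff_mem I hτ rfl) := stringComplex_d hτ n
  have hdK (n : ℤ) : K.d n (n + 1) = termHom (diff I _) (diff_mem I h₁ rfl) := stringComplex_d h₁ n
  have hdL (n : ℤ) : L.d n (n + 1) = termHom (diff I _) (diff_mem I h₂ rfl) := stringComplex_d h₂ n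
  have ha₁ (n : ℤ) : a₁ n ≫ K.d n (n + 1) =
      φ.f (n + 1) ≫ b₁ (n + 1) - F.d (n + 1) (n + 1 + 1) ≫ a₁ (n + 1) := by
    rw [hdF, hdK]
    refine termHom_ext fun v => ?_
    have := H.comm_S₁ v.1
    rw [← singleTotal_apply] at this
    exact this.symm
  have ha₂ (n : ℤ) : a₂ n ≫ L.d n (n + 1) =
      φ.f (n + 1) ≫ b₂ (n + 1) - F.d (n + 1) (n + 1 + 1) ≫ a₂ (n + 1) := by
    rw [hdF, hdL]
    refine termHom_ext fun v => ?_
    have := H.comm_S₂ v.1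
    rw [← singleTotal_apply] at this
    exact this.symm
  have hb₁ (n : ℤ) : b₁ n ≫ K.d n (n + 1) = G.d n (n + 1) ≫ b₁ (n + 1) := by
    rw [hdG, hdK]
    exact termHom_ext fun v => (H.comm_T₁ v.1).symm
  have hb₂ (n : ℤ) : b₂ n ≫ L.d n (n + 1) = G.d n (n + 1) ≫ b₂ (n + 1) := by
    rw [hdG, hdL]
    exact termHom_ext fun v => (H.comm_T₂ v.1).symm
  have e₁ (n : ℤ) : a₁ n ≫ a₁' n + a₂ n ≫ a₂' n = 𝟙 _ :=
    termHom_ext fun v => bwd_fwd_SS l r v.1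
  have e₂ (n : ℤ) : a₁ n ≫ b₁' n + a₂ n ≫ b₂' n = 0 :=
    termHom_ext fun v => bwd_fwd_ST v.1
  have e₃ (n : ℤ) : b₁ n ≫ a₁' n + b₂ n ≫ a₂' n = 0 :=
    termHom_ext fun v => bwd_fwd_TS l r v.1
  have e₄ (n : ℤ) : b₁ n ≫ b₁' n + b₂ n ≫ b₂' n = 𝟙 _ :=
    termHom_ext fun v => bwd_fwd_TT l r v.1
  have e₅ (n : ℤ) : a₁' n ≫ a₁ n + b₁' n ≫ b₁ n = 𝟙 _ :=
    termHom_ext fun v => fwd_bwd₁₁ l r v.1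
  have e₆ (n : ℤ) : a₁' n ≫ a₂ n + b₁' n ≫ b₂ n = 0 :=
    termHom_ext fun v => fwd_bwd₁₂ r v.1
  have e₇ (n : ℤ) : a₂' n ≫ a₁ n + b₂' n ≫ b₁ n = 0 :=
    termHom_ext fun v => fwd_bwd₂₁ l v.1
  have e₈ (n : ℤ) : a₂' n ≫ a₂ n + b₂' n ≫ b₂ n = 𝟙 _ :=
    termHom_ext fun v => fwd_bwd₂₂ l r v.1
  exact nonempty_mappingCone_iso_biprod φ a₁ a₂ b₁ b₂ a₁' a₂' b₁' b₂' ha₁ ha₂ hb₁ hb₂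
    e₁ e₂ e₃ e₄ e₅ e₆ e₇ e₈

end

end GentleCone

end

open GentleCone in
theorem mainTheorem2 {k V E : Type*} [Field k] [IsAlgClosed k] [Fintype V] [Fintype E]
    (Q : Quiv V E) (I : Ideal (PathAlgebra k Q)) [I.IsTwoSided] (hI : IsGentle Q I)
    (σ τ : GWord V E) (hσ : IsHomotopyString Q I σ) (hτ : IsHomotopyString Q I τ)
    (f fL fR : List E) (hf : IsSingletonSingleMap I σ τ f fL fR) :
    ∃ (h₁ : IsHomotopyString Q I (coneString₁ σ τ f))
      (h₂ : IsHomotopyString Q I (coneString₂ σ τ f fL fR)),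
      Nonempty (CochainComplex.mappingCone (singleMap I hσ hτ hf.toIsSingleMap) ≅
        stringComplex I (coneString₁ σ τ f) h₁ ⊞
          stringComplex I (coneString₂ σ τ f fL fR) h₂) :=
  ⟨hf.isHomotopyString_coneString₁ hI hσ hτ, hf.isHomotopyString_coneString₂ hI hσ hτ, hf.nonempty_iso hI hσ hτ _ _⟩
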